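/- Let $v_1,v_2,v_3\in\mathbb R^2$ be non-collinear, let $\triangle=\mathrm{co}\{v_1,v_2,v_3\}$ be the closed triangle they span, $q$ its circumcenter, and $\varphi(y)=\min_{i} v_i\cdot y$. For $\varepsilon,t>0$ let $$u^\varepsilon_t(x)=-\varepsilon\log\Big(\frac1{2\pi\varepsilon t}\int_{\mathbb R^2}\exp\Big(-\frac{|x-y|^2}{2\varepsilon t}-\frac{\varphi(y)}\varepsilon\Big)dy\Big),$$ the Cole–Hopf solution of $\partial_tu+\frac12|\nabla u|^2=\frac\varepsilon2\Delta u$ with initial data $\varphi$. Let $t\mapsto X^\varepsilon_t(y)$, $t\ge0$, be the continuous path with $X^\varepsilon_0(y)=y$ and $\partial_tX^\varepsilon_t(y)=\nabla u^\varepsilon_t(X^\varepsilon_t(y))$ for all $t>0$; let $X_t(y)=\lim_{\varepsilon\to0^+}X^\varepsilon_t(y)$, and let $\rho_t=(X_t)_\sharp\mathrm{Leb}$ be the pushforward of Lebesgue measure. Let $w_t(x)=\sup_y\big(x\cdot y-\frac12|y|^2-t\varphi(y)\big)$, with subgradient $\partial w_t(x)=\{p: w_t(z)\ge w_t(x)+p\cdot(z-x)\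 \forall z\}$, and let $\mu_t$ be its Monge–Ampère measure, $\mu_t(B)=|\partial w_t(B)|$ for Borel sets $B$. These objects are well defined: for all $\varepsilon>0$ and $y$ the path $X^\varepsilon_t(y)$, $t\ge0$, exists and is unique; the limit $X_t(y)$ exists for all $t\ge0$ and $y$; $X_t$ is continuous for each $t\ge0$; and for each $t>0$ the set function $B\mapsto|\partial w_t(B)|$ is a Borel measure. Moreover the following are equivalent: (i) $q\in\triangle$; (ii) $\rho_t=\mu_t$ for all $t>0$; (iii) $\rho_t=\mu_t$ for some $t>0$. If $q\notin\triangle$, then for every $t>0$ the measure $\rho_t$ has no atoms: $\rho_t(\{x\})=0$ for all $x\in\mathbb R^2$. On the other hand, $\mu_t(\{tq\})>0$ for every $t>0$, whether or not $q\in\triangle$. -/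

import Mathlib

open MeasureTheory Filter Topology Set

noncomputable section

namespace Adhesion

/-- The Cole-Hopf potential
`u^ε_t(x) = -ε log ((2πεt)^{-d/2} ∫ exp (-|x-y|²/(2εt) - φ(y)/ε) dy)`, the solution of
`∂ₜu + |∇u|²/2 = (ε/2) Δu` with initial data `φ`. -/
def viscousPotential {d : ℕ} (φ : EuclideanSpace ℝ (Fin d) → ℝ) (ε t : ℝ)
    (x : EuclideanSpace ℝ (Fin d)) : ℝ :=
  -ε * Real.log (1 / (2 * Real.pi * ε * t) ^ ((d : ℝ) / 2) *
    ∫ y, Real.exp (-‖x - y‖ ^ 2 / (2 * ε * t) - φ y / ε))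

/-- `z` is the trajectory from `y`, on `[0, ∞)`, of the viscous velocity field
`v^ε = ∇u^ε`. The field is smooth only for `t > 0`, so the equation is required there and
`z` is required to be continuous up to `t = 0`. -/
def IsViscousPath {d : ℕ} (φ : EuclideanSpace ℝ (Fin d) → ℝ) (ε : ℝ)
    (y : EuclideanSpace ℝ (Fin d)) (z : ℝ → EuclideanSpace ℝ (Fin d)) : Prop :=
  z 0 = y ∧ ContinuousOn z (Ici 0) ∧
    ∀ t, 0 < t → HasDerivAt z (gradient (viscousPotential φ ε t) (z t)) t

/-- The viscous Lagrangian flow map `X^ε_t(y)`. -/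
def viscousFlow {d : ℕ} (φ : EuclideanSpace ℝ (Fin d) → ℝ) (ε t : ℝ)
    (y : EuclideanSpace ℝ (Fin d)) : EuclideanSpace ℝ (Fin d) :=
  Classical.epsilon (IsViscousPath φ ε y) t

/-- The Lagrangian flow map of the adhesion model, `X_t(y) = lim_{ε → 0+} X^ε_t(y)`. -/
def lagrangianFlow {d : ℕ} (φ : EuclideanSpace ℝ (Fin d) → ℝ) (t : ℝ)
    (y : EuclideanSpace ℝ (Fin d)) : EuclideanSpace ℝ (Fin d) :=
  limUnder (𝓝[>] (0 : ℝ)) (fun ε => viscousFlow φ ε t y)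

/-- The mass distribution `ρ_t`, the pushforward of Lebesgue measure under `X_t`. -/
def massMeasure {d : ℕ} (φ : EuclideanSpace ℝ (Fin d) → ℝ) (t : ℝ) :
    Measure (EuclideanSpace ℝ (Fin d)) :=
  Measure.map (lagrangianFlow φ t) volume

/-- The convex potential `w_t(x) = sup_y (x·y - |y|²/2 - t φ(y))`. -/
def convexPotential {d : ℕ} (φ : EuclideanSpace ℝ (Fin d) → ℝ) (t : ℝ)
    (x : EuclideanSpace ℝ (Fin d)) : ℝ :=
  ⨆ y : EuclideanSpace ℝ (Fin d), (inner ℝ x y - ‖y‖ ^ 2 / 2 - t * φ y)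

/-- The subgradient `∂w(x)`. -/
def subgradient {d : ℕ} (w : EuclideanSpace ℝ (Fin d) → ℝ) (x : EuclideanSpace ℝ (Fin d)) :
    Set (EuclideanSpace ℝ (Fin d)) :=
  {p | ∀ z, w x + inner ℝ p (z - x) ≤ w z}

/-- `μ` is the Monge-Ampère measure of `w`: `μ(B) = |∂w(B)|` for all Borel sets `B`. -/
def IsMongeAmpereMeasure {d : ℕ} (w : EuclideanSpace ℝ (Fin d) → ℝ)
    (μ : Measure (EuclideanSpace ℝ (Fin d))) : Prop :=
  ∀ B, MeasurableSet B → μ B = volume (⋃ x ∈ B, subgradient w x)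

/-- The Monge-Ampère measure of `w`. -/
def mongeAmpere {d : ℕ} (w : EuclideanSpace ℝ (Fin d) → ℝ) :
    Measure (EuclideanSpace ℝ (Fin d)) :=
  Classical.epsilon (IsMongeAmpereMeasure w)

/-- The three-sector initial velocity potential `φ(y) = min_i v_i·y`. -/
def threeSector (v : Fin 3 → EuclideanSpace ℝ (Fin 2)) (y : EuclideanSpace ℝ (Fin 2)) : ℝ :=
  Finset.univ.inf' Finset.univ_nonempty (fun i => inner ℝ (v i) y)

end Adhesion

end

noncomputable section

namespace Adhesion

/-! Put `b i = v i - q`; all `b i` have norm `R`, the circumradius. In the frame `x ↦ x - t • q` the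
inviscid potential `min_i (v i · x - t ‖v i‖² / 2)` becomes, up to a linear term `q · x` and a
constant in `x`, the time-independent concave function `f = threeSector b`. The Cole–Hopf potential
is concave and within `ε log 3` of the inviscid one, so in this frame a viscous path has velocity in
the `ε log 3`-supergradient of `f` (`IsViscousPath.isApproxGradientPath`). Monotonicity of
supergradients makes such paths Cauchy as `ε → 0`; the limit is the gradient flow `S` of `f`, a
nonexpansive semigroup compatible with the homogeneity of `f`.

On the other side, `y ∈ ∂w_t(x)` exactly when `x - t • q` is the resolvent of `y`, that is, one
implicit Euler step of length `t` (`mem_subgradient_convexPotential_iff`). So `μ_t` is the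
pushforward under the resolvent, and the question is whether the flow equals its own implicit Euler
step.

If `0 ∈ co b`, it does. The velocity `p` at a point can be taken orthogonal to the face of active
gradients, because the midpoint of two vectors of equal norm is orthogonal to their difference. Then
`f` is linear along `p` both forwards and backwards, and the resolvent inequality propagates in time
(`IsGradientFlow.isResolvent`).

If `0 ∉ co b`, some barycentric coordinate of the circumcenter is negative. The other two gradients
are `m + e` and `m - e` with `m ⊥ e` and `m ≠ 0`, and they govern the half-plane `⟪m, x⟫ ≥ 0`, where
mass drains along the ray through `m`. Scaling and countability of atoms force any atom at time `s`
to sit at `s • m`, and only points of the line `⟪m, y⟫ = 0` can get there, a null set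
(`IsDriftFrame.measure_flow_fiber_eq_zero`). But `μ_t` always has an atom at `t • q`, since `∂w_t(t
• q)` contains the nondegenerate triangle `-t • co b`. Hence the two measures differ for every `t >
0`. -/

theorem tendsto_of_norm_sq_le {E : Type*} [NormedAddCommGroup E] {z : ℝ → E} {x : E} {C : ℝ}
    (h : ∀ δ > 0, ‖z δ - x‖ ^ 2 ≤ C * δ) : Tendsto z (𝓝[>] 0) (𝓝 x) := by
  rw [tendsto_iff_norm_sub_tendsto_zero]
  have hlim : Tendsto (fun δ : ℝ => √(C * δ)) (𝓝[>] 0) (𝓝 (√(C * 0))) :=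
    (Continuous.tendsto (by fun_prop) _).mono_left nhdsWithin_le_nhds
  rw [mul_zero, Real.sqrt_zero] at hlim
  refine squeeze_zero' (Eventually.of_forall fun _ => norm_nonneg _) ?_ hlim
  filter_upwards [eventually_mem_nhdsWithin] with δ hδ
  exact Real.le_sqrt_of_sq_le (h δ hδ)

/-! ### Gradient flows of concave functions as limits of approximate paths. -/

section GradientFlow

variable {E : Type*} [NormedAddCommGroup E] [InnerProductSpace ℝ E]

/-- A path on `[0, T]` whose velocity is a supergradient of `f` up to an error `δ`. -/
def IsApproxGradientPath (f : E → ℝ) (δ T : ℝ) (z : ℝ → E) : Prop :=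
  ContinuousOn z (Icc 0 T) ∧ ∀ t ∈ Ioo 0 T, ∃ p, HasDerivAt z p t ∧
    ∀ w, f w ≤ f (z t) + inner ℝ p (w - z t) + δ

/-- `S` is the gradient flow of `f`: its orbits are the limits of approximate gradient paths. -/
def IsGradientFlow (f : E → ℝ) (S : ℝ → E → E) : Prop :=
  ∀ y T δ, 0 ≤ T → 0 < δ → ∃ z, z 0 = y ∧ IsApproxGradientPath f δ T z ∧
    ∀ t ∈ Icc 0 T, ‖z t - S t y‖ ^ 2 ≤ 2 * δ * t

/-- Energy estimate: `‖z₁ - z₂‖² - 2 δ t` has nonpositive derivative. -/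
theorem norm_sub_sq_le_of_inner_deriv_le {z₁ z₂ : ℝ → E} {δ T : ℝ}
    (h₁ : ContinuousOn z₁ (Icc 0 T)) (h₂ : ContinuousOn z₂ (Icc 0 T))
    (hder : ∀ t ∈ Ioo 0 T, ∃ p₁ p₂, HasDerivAt z₁ p₁ t ∧ HasDerivAt z₂ p₂ t ∧
      inner ℝ (p₁ - p₂) (z₁ t - z₂ t) ≤ δ) {t : ℝ} (ht : t ∈ Icc 0 T) :
    ‖z₁ t - z₂ t‖ ^ 2 ≤ ‖z₁ 0 - z₂ 0‖ ^ 2 + 2 * δ * t := by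
  have hder' : ∀ s ∈ Ioo 0 T, ∃ g', g' ≤ 0 ∧
      HasDerivAt (fun s => ‖z₁ s - z₂ s‖ ^ 2 - 2 * δ * s) g' s := by
    intro s hs
    obtain ⟨p₁, p₂, hp₁, hp₂, hp⟩ := hder s hs
    refine ⟨_, ?_, ((hp₁.sub hp₂).norm_sq).sub ((hasDerivAt_id s).const_mul (2 * δ))⟩
    rw [real_inner_comm] at hp
    simp only [Pi.sub_apply]
    linarith
  have hanti : AntitoneOn (fun s => ‖z₁ s - z₂ s‖ ^ 2 - 2 * δ * s) (Icc 0 T) := by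
    refine antitoneOn_of_deriv_nonpos (convex_Icc 0 T) ?_ ?_ ?_
    · exact (((h₁.sub h₂).norm).pow 2).sub (by fun_prop)
    · rw [interior_Icc]
      intro s hs
      obtain ⟨g', -, hg⟩ := hder' s hs
      exact hg.differentiableAt.differentiableWithinAt
    · rw [interior_Icc]
      intro s hs
      obtain ⟨g', hg0, hg⟩ := hder' s hs
      rwa [hg.deriv]
  have := hanti ⟨le_rfl, ht.1.trans ht.2⟩ ht ht.1
  simp only [mul_zero, sub_zero] at this
  linarith

theorem inner_sub_sub_le_of_supergradients {f : E → ℝ} {x₁ x₂ p₁ p₂ : E} {δ₁ δ₂ : ℝ}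
    (h₁ : f x₂ ≤ f x₁ + inner ℝ p₁ (x₂ - x₁) + δ₁)
    (h₂ : f x₁ ≤ f x₂ + inner ℝ p₂ (x₁ - x₂) + δ₂) :
    inner ℝ (p₁ - p₂) (x₁ - x₂) ≤ δ₁ + δ₂ := by
  have e : inner ℝ (p₁ - p₂) (x₁ - x₂) = - inner ℝ p₁ (x₂ - x₁) - inner ℝ p₂ (x₁ - x₂) := by
    simp only [inner_sub_left, inner_sub_right]
    ring
  linarith

theorem IsApproxGradientPath.norm_sub_sq_le {f : E → ℝ} {δ₁ δ₂ T : ℝ} {z₁ z₂ : ℝ → E}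
    (h₁ : IsApproxGradientPath f δ₁ T z₁) (h₂ : IsApproxGradientPath f δ₂ T z₂) {t : ℝ}
    (ht : t ∈ Icc 0 T) :
    ‖z₁ t - z₂ t‖ ^ 2 ≤ ‖z₁ 0 - z₂ 0‖ ^ 2 + 2 * (δ₁ + δ₂) * t := by
  refine norm_sub_sq_le_of_inner_deriv_le h₁.1 h₂.1 (fun s hs => ?_) ht
  obtain ⟨p₁, hp₁, hf₁⟩ := h₁.2 s hs
  obtain ⟨p₂, hp₂, hf₂⟩ := h₂.2 s hs
  exact ⟨p₁, p₂, hp₁, hp₂, inner_sub_sub_le_of_supergradients (hf₁ (z₂ s)) (hf₂ (z₁ s))⟩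

theorem IsApproxGradientPath.shift {f : E → ℝ} {δ T τ : ℝ} {z : ℝ → E}
    (h : IsApproxGradientPath f δ (τ + T) z) (hτ : 0 ≤ τ) :
    IsApproxGradientPath f δ T (fun t => z (τ + t)) := by
  refine ⟨h.1.comp (by fun_prop) (fun t ht => ⟨by linarith [ht.1], by linarith [ht.2]⟩), ?_⟩
  intro t ht
  obtain ⟨p, hp, hf⟩ := h.2 (τ + t) ⟨by linarith [ht.1], by linarith [ht.2]⟩
  exact ⟨p, hp.comp_const_add τ t, hf⟩

/-- Approximate gradient paths of a positively homogeneous function can be rescaled. -/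
theorem IsApproxGradientPath.rescale {f : E → ℝ} (hf : ∀ a : ℝ, 0 < a → ∀ x, f (a • x) = a * f x)
    {δ T a : ℝ} (ha : 0 < a) {z : ℝ → E} (h : IsApproxGradientPath f δ T z) :
    IsApproxGradientPath f (a * δ) (a * T) (fun t => a • z (t / a)) := by
  refine ⟨(h.1.comp (by fun_prop) (fun t ht => ?_)).const_smul a, ?_⟩
  · exact ⟨div_nonneg ht.1 ha.le, by rw [div_le_iff₀ ha]; linarith [ht.2]⟩
  · intro t ht
    obtain ⟨p, hp, hw⟩ := h.2 (t / a) ⟨div_pos ht.1 ha, by rw [div_lt_iff₀ ha]; linarith [ht.2]⟩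
    refine ⟨p, ?_, fun w => ?_⟩
    · have h1 : HasDerivAt (fun t : ℝ => t / a) (1 / a) t := (hasDerivAt_id t).div_const a
      have h2 := (hp.scomp t h1).const_smul a
      rw [smul_smul, mul_one_div_cancel ha.ne', one_smul] at h2
      exact h2
    · have h1 := mul_le_mul_of_nonneg_left (hw (a⁻¹ • w)) ha.le
      have h2 : f w = a * f (a⁻¹ • w) := by rw [← hf a ha, smul_inv_smul₀ ha.ne']
      have h3 : w - a • z (t / a) = a • (a⁻¹ • w - z (t / a)) := by
        rw [smul_sub, smul_inv_smul₀ ha.ne']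
      rw [h2, hf a ha, h3, real_inner_smul_right]
      linarith

theorem isApproxGradientPath_segment {f : E → ℝ} {x p : E} {T : ℝ}
    (h : ∀ t ∈ Ioo 0 T, ∀ w, f w ≤ f (x + t • p) + inner ℝ p (w - (x + t • p))) :
    IsApproxGradientPath f 0 T (fun t => x + t • p) := by
  refine ⟨by fun_prop, fun t ht => ⟨p, ?_, fun w => by simpa using h t ht w⟩⟩
  simpa using ((hasDerivAt_id t).smul_const p).const_add x

namespace IsGradientFlow

variable {f : E → ℝ} {S : ℝ → E → E}

theorem norm_sub_le (hS : IsGradientFlow f S) {t : ℝ} (ht : 0 ≤ t) (y₁ y₂ : E) :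
    ‖S t y₁ - S t y₂‖ ≤ ‖y₁ - y₂‖ := by
  have key : ∀ δ > 0, ‖S t y₁ - S t y₂‖ ≤ √(‖y₁ - y₂‖ ^ 2 + 4 * δ * t) + 2 * √(2 * δ * t) := by
    intro δ hδ
    obtain ⟨z₁, h0₁, hz₁, hd₁⟩ := hS y₁ t δ ht hδ
    obtain ⟨z₂, h0₂, hz₂, hd₂⟩ := hS y₂ t δ ht hδ
    have h := hz₁.norm_sub_sq_le hz₂ ⟨ht, le_rfl⟩
    rw [h0₁, h0₂] at h
    have a₁ := Real.le_sqrt_of_sq_le (hd₁ t ⟨ht, le_rfl⟩)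
    have a₂ := Real.le_sqrt_of_sq_le (hd₂ t ⟨ht, le_rfl⟩)
    have a₃ : ‖z₁ t - z₂ t‖ ≤ √(‖y₁ - y₂‖ ^ 2 + 4 * δ * t) :=
      Real.le_sqrt_of_sq_le (by linarith)
    have a₄ : S t y₁ - S t y₂ = (z₁ t - z₂ t) - (z₁ t - S t y₁) + (z₂ t - S t y₂) := by abel
    calc ‖S t y₁ - S t y₂‖ ≤ ‖z₁ t - z₂ t‖ + ‖z₁ t - S t y₁‖ + ‖z₂ t - S t y₂‖ := by
          rw [a₄]
          exact (norm_add_le _ _).trans (by gcongr; exact _root_.norm_sub_le _ _)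
      _ ≤ _ := by linarith
  have hlim : Tendsto (fun δ : ℝ => √(‖y₁ - y₂‖ ^ 2 + 4 * δ * t) + 2 * √(2 * δ * t)) (𝓝[>] 0)
      (𝓝 (√(‖y₁ - y₂‖ ^ 2 + 4 * 0 * t) + 2 * √(2 * 0 * t))) :=
    (Continuous.tendsto (by fun_prop) _).mono_left nhdsWithin_le_nhds
  simp only [mul_zero, zero_mul, add_zero, Real.sqrt_zero, Real.sqrt_sq (norm_nonneg _)] at hlim
  exact ge_of_tendsto hlim (eventually_mem_nhdsWithin.mono fun δ hδ => key δ hδ)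

theorem continuous (hS : IsGradientFlow f S) {t : ℝ} (ht : 0 ≤ t) : Continuous (S t) :=
  (LipschitzWith.of_dist_le_mul (K := 1) fun y₁ y₂ => by
    simpa [dist_eq_norm] using hS.norm_sub_le ht y₁ y₂).continuous

/-- An approximate gradient path shadows the orbit of its starting point. -/
theorem norm_path_sub_sq_le (hS : IsGradientFlow f S) {δ T : ℝ} {z : ℝ → E}
    (hz : IsApproxGradientPath f δ T z) {t : ℝ} (ht : t ∈ Icc 0 T) :
    ‖z t - S t (z 0)‖ ^ 2 ≤ 2 * δ * t := by
  have hlim : Tendsto (fun η : ℝ => (√(2 * (δ + η) * t) + √(2 * η * t))) (𝓝[>] 0)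
      (𝓝 (√(2 * (δ + 0) * t) + √(2 * 0 * t))) :=
    (Continuous.tendsto (by fun_prop) _).mono_left nhdsWithin_le_nhds
  have key : ∀ η > 0, ‖z t - S t (z 0)‖ ≤ √(2 * (δ + η) * t) + √(2 * η * t) := by
    intro η hη
    obtain ⟨z', h0, hz', hd⟩ := hS (z 0) T η (ht.1.trans ht.2) hη
    have h := hz.norm_sub_sq_le hz' ht
    rw [h0, sub_self, norm_zero] at h
    calc ‖z t - S t (z 0)‖ ≤ ‖z t - z' t‖ + ‖z' t - S t (z 0)‖ :=
          norm_sub_le_norm_sub_add_norm_sub _ _ _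
      _ ≤ _ := add_le_add (Real.le_sqrt_of_sq_le (by linarith)) (Real.le_sqrt_of_sq_le (hd t ht))
  have h1 := ge_of_tendsto hlim (eventually_mem_nhdsWithin.mono fun δ hδ => key δ hδ)
  -- No sign of `δ` is assumed; the comparison estimate itself forces `2 * (δ + η) * t ≥ 0` for
  -- every `η > 0`.
  have h2 : 0 ≤ 2 * δ * t := by
    refine ge_of_tendsto (x := 𝓝[>] (0 : ℝ)) (f := fun η => 2 * (δ + η) * t) ?_ ?_
    · have : Tendsto (fun η : ℝ => 2 * (δ + η) * t) (𝓝 0) (𝓝 (2 * (δ + 0) * t)) :=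
        Continuous.tendsto (by fun_prop) _
      simpa using this.mono_left nhdsWithin_le_nhds
    · filter_upwards [eventually_mem_nhdsWithin] with η hη
      obtain ⟨z', h0, hz', hd⟩ := hS (z 0) T η (ht.1.trans ht.2) hη
      have h := hz.norm_sub_sq_le hz' ht
      rw [h0, sub_self, norm_zero] at h
      nlinarith [sq_nonneg ‖z t - z' t‖]
  simp only [mul_zero, zero_mul, add_zero, Real.sqrt_zero] at h1
  calc ‖z t - S t (z 0)‖ ^ 2 ≤ √(2 * δ * t) ^ 2 := by gcongr
    _ = _ := Real.sq_sqrt h2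

theorem eq_of_path (hS : IsGradientFlow f S) {T : ℝ} {z : ℝ → E}
    (hz : IsApproxGradientPath f 0 T z) {t : ℝ} (ht : t ∈ Icc 0 T) : S t (z 0) = z t := by
  have h := hS.norm_path_sub_sq_le hz ht
  have h' : ‖z t - S t (z 0)‖ = 0 := by nlinarith [norm_nonneg (z t - S t (z 0))]
  exact (sub_eq_zero.mp (norm_eq_zero.mp h')).symm

/-- All explicit orbits below are found this way: a segment whose constant velocity stays a
supergradient along it is an exact path, and exact paths are orbits. -/
theorem eq_segment (hS : IsGradientFlow f S) {x p : E} {T : ℝ} (hT : 0 ≤ T)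
    (h : ∀ t ∈ Ioo 0 T, ∀ w, f w ≤ f (x + t • p) + inner ℝ p (w - (x + t • p))) :
    S T x = x + T • p := by
  simpa using hS.eq_of_path (isApproxGradientPath_segment h) ⟨hT, le_rfl⟩

theorem map_zero (hS : IsGradientFlow f S) (y : E) : S 0 y = y := by
  obtain ⟨z, h0, -, hd⟩ := hS y 0 1 le_rfl one_pos
  have h := hd 0 (by simp)
  rw [h0, mul_zero] at h
  have h' : ‖y - S 0 y‖ = 0 := by nlinarith [norm_nonneg (y - S 0 y)]
  exact (sub_eq_zero.mp (norm_eq_zero.mp h')).symm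

theorem map_add (hS : IsGradientFlow f S) {τ t : ℝ} (hτ : 0 ≤ τ) (ht : 0 ≤ t) (y : E) :
    S (τ + t) y = S t (S τ y) := by
  -- Positivity of `δ` sits inside the existential so that `choose` yields a family indexed by `ℝ`;
  -- its values at `δ ≤ 0` are irrelevant.
  have hex : ∀ δ : ℝ, ∃ z : ℝ → E, 0 < δ → z 0 = y ∧ IsApproxGradientPath f δ (τ + t) z ∧
    ∀ s ∈ Icc 0 (τ + t), ‖z s - S s y‖ ^ 2 ≤ 2 * δ * s := by
    intro δ
    by_cases hδ : 0 < δ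
    · obtain ⟨z, hz⟩ := hS y (τ + t) δ (by linarith) hδ
      exact ⟨z, fun _ => hz⟩
    · exact ⟨0, fun h => absurd h hδ⟩
  choose z hz using hex
  have h1 : Tendsto (fun δ => z δ (τ + t)) (𝓝[>] 0) (𝓝 (S (τ + t) y)) :=
    tendsto_of_norm_sq_le (C := 2 * (τ + t)) fun δ hδ =>
      ((hz δ hδ).2.2 _ ⟨by linarith, le_rfl⟩).trans (by linarith)
  have h2 : Tendsto (fun δ => z δ τ) (𝓝[>] 0) (𝓝 (S τ y)) :=
    tendsto_of_norm_sq_le (C := 2 * τ) fun δ hδ =>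
      ((hz δ hδ).2.2 _ ⟨by linarith, by linarith⟩).trans (by linarith)
  have h3 : Tendsto (fun δ => z δ (τ + t) - S t (z δ τ)) (𝓝[>] 0) (𝓝 0) :=
    tendsto_of_norm_sq_le (C := 2 * t) fun δ hδ => by
      have := hS.norm_path_sub_sq_le ((hz δ hδ).2.1.shift hτ) (t := t) ⟨ht, le_rfl⟩
      simp only [add_zero] at this
      rw [sub_zero]
      linarith
  have h4 := h1.sub (((hS.continuous ht).tendsto _).comp h2)
  exact sub_eq_zero.mp (tendsto_nhds_unique h4 h3)

theorem map_smul (hS : IsGradientFlow f S) (hf : ∀ a : ℝ, 0 < a → ∀ x, f (a • x) = a * f x)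
    {a t : ℝ} (ha : 0 < a) (ht : 0 ≤ t) (y : E) : S (a * t) (a • y) = a • S t y := by
  have hex : ∀ δ : ℝ, ∃ z : ℝ → E, 0 < δ → z 0 = y ∧ IsApproxGradientPath f δ t z ∧
    ∀ s ∈ Icc 0 t, ‖z s - S s y‖ ^ 2 ≤ 2 * δ * s := by
    intro δ
    by_cases hδ : 0 < δ
    · obtain ⟨z, hz⟩ := hS y t δ ht hδ
      exact ⟨z, fun _ => hz⟩
    · exact ⟨0, fun h => absurd h hδ⟩
  choose z hz using hex
  have h1 : Tendsto (fun δ => a • z δ t) (𝓝[>] 0) (𝓝 (a • S t y)) :=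
    (tendsto_of_norm_sq_le (C := 2 * t) fun δ hδ =>
      ((hz δ hδ).2.2 _ ⟨ht, le_rfl⟩).trans (by linarith)).const_smul a
  have h2 : Tendsto (fun δ => a • z δ t) (𝓝[>] 0) (𝓝 (S (a * t) (a • y))) :=
    tendsto_of_norm_sq_le (C := 2 * a * (a * t)) fun δ hδ => by
      have := hS.norm_path_sub_sq_le ((hz δ hδ).2.1.rescale hf ha) (t := a * t)
        ⟨by positivity, le_rfl⟩
      simp only [zero_div, (hz δ hδ).1, mul_div_cancel_left₀ _ ha.ne'] at this
      linarith
  exact tendsto_nhds_unique h2 h1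

/-- On compact intervals the orbit is a uniform limit of continuous approximate paths. -/
theorem continuousOn_time (hS : IsGradientFlow f S) (y : E) :
    ContinuousOn (fun t => S t y) (Ici 0) := by
  have hIcc : ∀ T ≥ 0, ContinuousOn (fun t => S t y) (Icc 0 T) := by
    intro T hT
    have hex : ∀ n : ℕ, ∃ z : ℝ → E, z 0 = y ∧ IsApproxGradientPath f (1 / ((n : ℝ) + 1)) T z ∧
        ∀ s ∈ Icc 0 T, ‖z s - S s y‖ ^ 2 ≤ 2 * (1 / ((n : ℝ) + 1)) * s :=
      fun n => hS y T _ hT Nat.one_div_pos_of_nat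
    choose z hz using hex
    have hu : TendstoUniformlyOn z (fun t => S t y) atTop (Icc 0 T) := by
      rw [Metric.tendstoUniformlyOn_iff]
      intro η hη
      have hl : Tendsto (fun n : ℕ => √(2 * (1 / ((n : ℝ) + 1)) * T)) atTop (𝓝 0) := by
        have := ((tendsto_one_div_add_atTop_nhds_zero_nat (𝕜 := ℝ)).const_mul 2).mul_const T
        simpa using this.sqrt
      filter_upwards [hl.eventually_lt_const hη] with n hn t ht
      rw [dist_comm, dist_eq_norm]
      refine lt_of_le_of_lt (Real.le_sqrt_of_sq_le (((hz n).2.2 t ht).trans ?_)) hn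
      exact mul_le_mul_of_nonneg_left ht.2 (by positivity)
    exact hu.continuousOn (Frequently.of_forall fun n => (hz n).2.1.1)
  intro t ht
  have ht' : (0 : ℝ) ≤ t := ht
  have h := hIcc (t + 1) (by linarith) t ⟨ht', by linarith⟩
  refine h.mono_of_mem_nhdsWithin ?_
  rw [← Ici_inter_Iic]
  exact inter_mem self_mem_nhdsWithin (mem_nhdsWithin_of_mem_nhds (Iic_mem_nhds (by linarith)))

end IsGradientFlow

end GradientFlow

/-! ### The minimum of three linear forms. -/

section ThreeSector

variable {b : Fin 3 → EuclideanSpace ℝ (Fin 2)}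

theorem threeSector_le (x : EuclideanSpace ℝ (Fin 2)) (i : Fin 3) :
    threeSector b x ≤ inner ℝ (b i) x :=
  Finset.inf'_le _ (Finset.mem_univ i)

theorem le_threeSector {x : EuclideanSpace ℝ (Fin 2)} {a : ℝ}
    (h : ∀ i, a ≤ inner ℝ (b i) x) : a ≤ threeSector b x :=
  Finset.le_inf' _ _ fun i _ => h i

theorem exists_threeSector_eq (b : Fin 3 → EuclideanSpace ℝ (Fin 2))
    (x : EuclideanSpace ℝ (Fin 2)) : ∃ i, inner ℝ (b i) x = threeSector b x := by
  obtain ⟨i, -, hi⟩ := Finset.exists_mem_eq_inf' (Finset.univ_nonempty (α := Fin 3))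
    (fun i => (inner ℝ (b i) x : ℝ))
  exact ⟨i, hi.symm⟩

theorem continuous_threeSector (b : Fin 3 → EuclideanSpace ℝ (Fin 2)) :
    Continuous (threeSector b) :=
  Continuous.finset_inf'_apply _ fun i _ => by fun_prop

theorem threeSector_smul {a : ℝ} (ha : 0 < a) (x : EuclideanSpace ℝ (Fin 2)) :
    threeSector b (a • x) = a * threeSector b x := by
  apply le_antisymm
  · obtain ⟨i, hi⟩ := exists_threeSector_eq b x
    rw [← hi, ← real_inner_smul_right]
    exact threeSector_le _ i
  · refine le_threeSector fun i => ?_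
    rw [real_inner_smul_right]
    exact mul_le_mul_of_nonneg_left (threeSector_le x i) ha.le

theorem threeSector_le_inner {p : EuclideanSpace ℝ (Fin 2)} (hp : p ∈ convexHull ℝ (range b))
    (x : EuclideanSpace ℝ (Fin 2)) : threeSector b x ≤ inner ℝ p x := by
  have : convexHull ℝ (range b) ⊆ {p | threeSector b x ≤ inner ℝ p x} := by
    refine convexHull_min (range_subset_iff.mpr (threeSector_le x)) ?_
    exact convex_halfSpace_ge ((innerₛₗ ℝ).flip x).isLinear _
  exact this hp

theorem threeSector_eq_zero {x : EuclideanSpace ℝ (Fin 2)} (h0 : 0 ∈ convexHull ℝ (range b))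
    (hx : ∀ i, inner ℝ (b i) x = threeSector b x) : threeSector b x = 0 := by
  apply le_antisymm (by simpa using threeSector_le_inner h0 x)
  have : convexHull ℝ (range b) ⊆ {p | inner ℝ p x ≤ threeSector b x} := by
    refine convexHull_min (range_subset_iff.mpr fun i => (hx i).le) ?_
    exact convex_halfSpace_le ((innerₛₗ ℝ).flip x).isLinear _
  simpa using this h0

/-- Inactive forms stay strictly above for small `h`, while active ones all change at the rate
`‖p‖²`. The neighbourhood is two-sided: the backward direction is needed for
`IsGradientFlow.isResolvent`. -/
theorem eventually_threeSector_add_smul {x p : EuclideanSpace ℝ (Fin 2)}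
    (hp : ∀ i, inner ℝ (b i) x = threeSector b x → inner ℝ (b i) p = ‖p‖ ^ 2) :
    ∀ᶠ h in 𝓝 (0 : ℝ), threeSector b (x + h • p) = threeSector b x + h * ‖p‖ ^ 2 := by
  have h1 : ∀ i, ∀ᶠ h in 𝓝 (0 : ℝ),
      threeSector b x + h * ‖p‖ ^ 2 ≤ inner ℝ (b i) (x + h • p) := by
    intro i
    by_cases hi : inner ℝ (b i) x = threeSector b x
    · refine Eventually.of_forall fun h => ?_
      rw [inner_add_right, real_inner_smul_right, hi, hp i hi]
    · have hlt := lt_of_le_of_ne (threeSector_le x i) (Ne.symm hi)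
      have h2 : ∀ᶠ h in 𝓝 (0 : ℝ),
          threeSector b x + h * ‖p‖ ^ 2 < inner ℝ (b i) (x + h • p) := by
        refine (Continuous.tendsto (by fun_prop) 0).eventually_lt
          (Continuous.tendsto (by fun_prop) 0) ?_
        simpa using hlt
      exact h2.mono fun _ => le_of_lt
  filter_upwards [eventually_all.mpr h1] with h hh
  refine le_antisymm ?_ (le_threeSector hh)
  obtain ⟨i, hi⟩ := exists_threeSector_eq b x
  have := threeSector_le (b := b) (x + h • p) i
  rwa [inner_add_right, real_inner_smul_right, hi, hp i hi] at this

/-- If the origin is the circumcenter of the triangle and lies in it, then the supergradient of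
least norm is orthogonal to the face of active gradients. -/
theorem exists_minimal_supergradient {R : ℝ} (hR : ∀ i, ‖b i‖ = R)
    (h0 : 0 ∈ convexHull ℝ (range b)) (x : EuclideanSpace ℝ (Fin 2)) :
    ∃ p : EuclideanSpace ℝ (Fin 2), (∀ w, threeSector b w ≤ inner ℝ p w) ∧
      inner ℝ p x = threeSector b x ∧
      ∀ i, inner ℝ (b i) x = threeSector b x → inner ℝ (b i) p = ‖p‖ ^ 2 := by
  by_cases hall : ∀ i, inner ℝ (b i) x = threeSector b x
  · refine ⟨0, fun w => threeSector_le_inner h0 w, ?_, fun i _ => by simp⟩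
    rw [inner_zero_left, threeSector_eq_zero h0 hall]
  · push Not at hall
    obtain ⟨k, hk⟩ := hall
    -- At most two forms are active; `i = j` covers the case of a single one.
    obtain ⟨i, j, hi, hj, hij⟩ : ∃ i j, inner ℝ (b i) x = threeSector b x ∧
        inner ℝ (b j) x = threeSector b x ∧
        ∀ l, inner ℝ (b l) x = threeSector b x → l = i ∨ l = j := by
      obtain ⟨i, hi⟩ := exists_threeSector_eq b x
      by_cases hex : ∃ j, j ≠ i ∧ inner ℝ (b j) x = threeSector b x
      · obtain ⟨j, hji, hj⟩ := hex
        refine ⟨i, j, hi, hj, fun l hl => ?_⟩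
        have h1 : l ≠ k := fun h => hk (h ▸ hl)
        have h2 : i ≠ k := fun h => hk (h ▸ hi)
        have h3 : j ≠ k := fun h => hk (h ▸ hj)
        omega
      · push Not at hex
        refine ⟨i, i, hi, hi, fun l hl => ?_⟩
        by_contra hne
        exact hex l (fun h => hne (Or.inl h)) hl
    have hn : ‖(2⁻¹ : ℝ) • (b i + b j)‖ ^ 2 = (R ^ 2 + inner ℝ (b i) (b j)) / 2 := by
      rw [norm_smul, mul_pow, norm_add_sq_real, hR, hR]
      norm_num
      ring
    refine ⟨(2⁻¹ : ℝ) • (b i + b j), fun w => ?_, ?_, fun l hl => ?_⟩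
    · rw [real_inner_smul_left, inner_add_left]
      linarith [threeSector_le (b := b) w i, threeSector_le (b := b) w j]
    · rw [real_inner_smul_left, inner_add_left, hi, hj]
      ring
    · rw [hn, real_inner_smul_right, inner_add_right]
      rcases hij l hl with rfl | rfl
      · rw [real_inner_self_eq_norm_sq, hR]
        ring
      · rw [real_inner_self_eq_norm_sq, hR, real_inner_comm]
        ring

end ThreeSector

/-! ### The resolvent, or implicit Euler step. -/

section Resolvent

variable {E : Type*} [NormedAddCommGroup E] [InnerProductSpace ℝ E]

/-- `x` is the resolvent at `y`: the vector `(x - y) / t` is a supergradient of `f` at `x`. -/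
def IsResolvent (f : E → ℝ) (t : ℝ) (y x : E) : Prop :=
  ∀ w, t * f w ≤ t * f x + inner ℝ (x - y) (w - x)

theorem IsResolvent.norm_sub_le {f : E → ℝ} {t : ℝ} {y₁ y₂ x₁ x₂ : E}
    (h₁ : IsResolvent f t y₁ x₁) (h₂ : IsResolvent f t y₂ x₂) : ‖x₁ - x₂‖ ≤ ‖y₁ - y₂‖ := by
  have e₁ := h₁ x₂
  have e₂ := h₂ x₁
  have e₃ : inner ℝ (x₁ - y₁) (x₂ - x₁) + inner ℝ (x₂ - y₂) (x₁ - x₂)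
      = inner ℝ (y₁ - y₂) (x₁ - x₂) - ‖x₁ - x₂‖ ^ 2 := by
    rw [← real_inner_self_eq_norm_sq]
    simp only [inner_sub_left, inner_sub_right]
    ring
  have e₄ := real_inner_le_norm (y₁ - y₂) (x₁ - x₂)
  by_contra! hlt
  nlinarith [norm_nonneg (y₁ - y₂), norm_nonneg (x₁ - x₂)]

/-- By duality: take `x = y + t • p` with `p` in the hull of the gradients minimising `‖y + t • p‖`.
Optimality says that `p` attains the minimum of `⟪·, x⟫` over the hull, which for `t > 0` makes it a
supergradient at `x`. -/
theorem exists_isResolvent_threeSector (b : Fin 3 → EuclideanSpace ℝ (Fin 2)) {t : ℝ}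
    (ht : 0 ≤ t) (y : EuclideanSpace ℝ (Fin 2)) : ∃ x, IsResolvent (threeSector b) t y x := by
  set K := convexHull ℝ (range b)
  have hKc : IsCompact K := (finite_range b).isCompact_convexHull ℝ
  have hKne : K.Nonempty := (range_nonempty b).convexHull
  obtain ⟨p, hpK, hp⟩ := hKc.exists_isMinOn hKne
    (f := fun p => ‖y + t • p‖) (by fun_prop)
  refine ⟨y + t • p, fun w => ?_⟩
  have hopt : ∀ k ∈ K, 0 ≤ t * inner ℝ (y + t • p) (k - p) := by
    intro k hk
    by_contra! hneg
    set A := t * inner ℝ (y + t • p) (k - p) with hA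
    set B := t ^ 2 * ‖k - p‖ ^ 2 with hB
    have hBnn : 0 ≤ B := by positivity
    have hmin : ∀ s ∈ Icc (0 : ℝ) 1, 0 ≤ 2 * s * A + s ^ 2 * B := by
      intro s hs
      have hmem : p + s • (k - p) ∈ K :=
        (convex_convexHull ℝ _).add_smul_sub_mem hpK hk hs
      have h1 : ‖y + t • p‖ ≤ ‖y + t • (p + s • (k - p))‖ := hp hmem
      have h2 : y + t • (p + s • (k - p)) = (y + t • p) + (s * t) • (k - p) := by module
      have h3 : ‖y + t • p‖ ^ 2 ≤ ‖y + t • (p + s • (k - p))‖ ^ 2 := by gcongr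
      rw [h2, norm_add_sq_real (y + t • p) ((s * t) • (k - p)), real_inner_smul_right,
        norm_smul (s * t), mul_pow, Real.norm_eq_abs, sq_abs] at h3
      rw [hA, hB]
      nlinarith
    rcases eq_or_lt_of_le hBnn with hB0 | hBpos
    · have := hmin 1 (by simp)
      rw [← hB0] at this
      linarith
    -- If `A < 0`, this `s` has `s * B ≤ -A`, so `2 s A + s² B ≤ s A < 0`.
    · have hs : min 1 (-A / B) ∈ Icc (0 : ℝ) 1 :=
        ⟨le_min zero_le_one (div_nonneg (by linarith) hBpos.le), min_le_left _ _⟩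
      have hspos : 0 < min 1 (-A / B) := lt_min one_pos (div_pos (by linarith) hBpos)
      have h1 := hmin _ hs
      have h2 : min 1 (-A / B) * B ≤ -A := by
        have := mul_le_mul_of_nonneg_right (min_le_right 1 (-A / B)) hBpos.le
        rwa [div_mul_cancel₀ _ hBpos.ne'] at this
      nlinarith
  have h1 : t * inner ℝ p (y + t • p) ≤ t * threeSector b (y + t • p) := by
    obtain ⟨i, hi⟩ := exists_threeSector_eq b (y + t • p)
    have := hopt (b i) (subset_convexHull ℝ _ (mem_range_self i))
    rw [inner_sub_right, real_inner_comm (b i), real_inner_comm p, hi] at this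
    linarith
  have h2 := mul_le_mul_of_nonneg_left (threeSector_le_inner hpK w) ht
  rw [add_sub_cancel_left, real_inner_smul_left, inner_sub_right]
  linarith

theorem isResolvent_threeSector_zero {b : Fin 3 → EuclideanSpace ℝ (Fin 2)} {t : ℝ} (ht : 0 ≤ t)
    {p : EuclideanSpace ℝ (Fin 2)} (hp : p ∈ convexHull ℝ (range b)) :
    IsResolvent (threeSector b) t (-t • p) 0 := by
  intro w
  have h0 : threeSector b 0 = 0 := by
    obtain ⟨i, hi⟩ := exists_threeSector_eq b 0
    rw [← hi, inner_zero_right]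
  have := mul_le_mul_of_nonneg_left (threeSector_le_inner hp w) ht
  simpa [h0, real_inner_smul_left] using this

end Resolvent

/-! ### Flow equals resolvent when the circumcenter is in the triangle. -/

section FlowResolvent

variable {b : Fin 3 → EuclideanSpace ℝ (Fin 2)}
  {S : ℝ → EuclideanSpace ℝ (Fin 2) → EuclideanSpace ℝ (Fin 2)}

/-- When the circumcenter lies in the triangle, the gradient flow coincides with the
resolvent. -/
theorem IsGradientFlow.isResolvent (hS : IsGradientFlow (threeSector b) S) {R : ℝ}
    (hR : ∀ i, ‖b i‖ = R) (h0 : 0 ∈ convexHull ℝ (range b)) {T : ℝ} (hT : 0 ≤ T)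
    (y : EuclideanSpace ℝ (Fin 2)) : IsResolvent (threeSector b) T y (S T y) := by
  have hcont := (hS.continuousOn_time y).mono (Icc_subset_Ici_self : Icc 0 T ⊆ Ici 0)
  have hmain : Icc 0 T ⊆ {t | IsResolvent (threeSector b) t y (S t y)} := by
    -- Continuous induction on time: the set of good times is closed, contains `0` and extends to
    -- the right of each of its points.
    refine IsClosed.Icc_subset_of_forall_mem_nhdsWithin ?_ ?_ ?_
    · have : {t | IsResolvent (threeSector b) t y (S t y)} ∩ Icc 0 T =
          ⋂ w, {t ∈ Icc 0 T | t * threeSector b w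
            ≤ t * threeSector b (S t y) + inner ℝ (S t y - y) (w - S t y)} := by
        ext t
        simp only [IsResolvent, mem_inter_iff, mem_ofPred_eq, mem_iInter]
        exact ⟨fun h w => ⟨h.2, h.1 w⟩, fun h => ⟨fun w => (h w).2, (h 0).1⟩⟩
      rw [this]
      refine isClosed_iInter fun w => isClosed_Icc.isClosed_le (by fun_prop) ?_
      exact (continuousOn_id.mul ((continuous_threeSector b).comp_continuousOn hcont)).add
        ((hcont.sub continuousOn_const).inner (continuousOn_const.sub hcont))
    · intro w
      simp [hS.map_zero]
    · rintro t ⟨ht, ht0, -⟩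
      obtain ⟨p, hp, hpx, hpi⟩ := exists_minimal_supergradient hR h0 (S t y)
      have hev := eventually_threeSector_add_smul hpi
      obtain ⟨η, hη, hball⟩ := Metric.eventually_nhds_iff.mp hev
      set x := S t y with hx
      have hloc : ∀ h, |h| < η → threeSector b (x + h • p) = threeSector b x + h * ‖p‖ ^ 2 :=
        fun h hh => hball (by simpa using hh)
      have hpath : ∀ h, 0 ≤ h → h < η → S (t + h) y = x + h • p := by
        intro h hh0 hh
        rw [hS.map_add ht0 hh0]
        refine hS.eq_segment hh0 fun s hs w => ?_
        rw [hloc s (by rw [abs_of_pos hs.1]; exact hs.2.trans hh), ← hpx, inner_sub_right,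
          inner_add_right, real_inner_smul_right, real_inner_self_eq_norm_sq]
        linarith [hp w]
      have hmem : Ioo t (t + η) ∈ 𝓝[>] t := Ioo_mem_nhdsGT (by linarith)
      refine mem_of_superset hmem fun r hr w => ?_
      obtain ⟨h, rfl⟩ : ∃ h, r = t + h := ⟨r - t, by ring⟩
      have hh0 : 0 < h := by linarith [hr.1]
      have hh : h < η := by linarith [hr.2]
      rw [hpath h hh0.le hh, hloc h (by rwa [abs_of_pos hh0])]
      have e₁ := ht w
      -- Testing the resolvent inequality at the backward point gives `h * ⟪x - y, p⟫ ≤ t * h *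
      -- ‖p‖²`, the only bound needed on the cross term in `e₅`.
      have e₂ := ht (x + (-h) • p)
      rw [hloc (-h) (by rwa [abs_neg, abs_of_pos hh0])] at e₂
      have e₃ := mul_le_mul_of_nonneg_left (hp w) hh0.le
      have e₄ : inner ℝ (x - y) (x + -h • p - x) = -h * inner ℝ (x - y) p := by
        rw [add_sub_cancel_left, real_inner_smul_right]
      have e₅ : inner ℝ (x + h • p - y) (w - (x + h • p)) = inner ℝ (x - y) (w - x)
          - h * inner ℝ (x - y) p + h * inner ℝ p w - h * threeSector b x - h * (h * ‖p‖ ^ 2) := by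
        have : x + h • p - y = (x - y) + h • p := by abel
        rw [this, ← sub_sub, ← hpx, ← real_inner_self_eq_norm_sq]
        simp only [inner_sub_right, inner_add_left, real_inner_smul_left, real_inner_smul_right]
        ring
      rw [e₄] at e₂
      rw [e₅]
      nlinarith
  exact hmain ⟨hT, le_rfl⟩

end FlowResolvent

/-! ### The drifting case: fibres of the flow are null. -/

section Drift

variable {E : Type*} [NormedAddCommGroup E] [InnerProductSpace ℝ E]

/-- The half-plane `{x | 0 ≤ ⟪m, x⟫}` is drained along the ray through `m`: there `f` is the
minimum of the linear functions with gradients `m + e` and `m - e`. -/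
structure IsDriftFrame (f : E → ℝ) (m e : E) : Prop where
  ne_zero : m ≠ 0
  le_add : ∀ w, f w ≤ inner ℝ (m + e) w
  le_sub : ∀ w, f w ≤ inner ℝ (m - e) w
  orthogonal : inner ℝ m e = 0
  apply_eq : ∀ a s : ℝ, 0 ≤ s → f (a • e + s • m) = s * ‖m‖ ^ 2 - |a| * ‖e‖ ^ 2
  exists_eq : ∀ y, inner ℝ m y = 0 → ∃ a : ℝ, y = a • e

namespace IsDriftFrame

variable {f : E → ℝ} {m e : E} {S : ℝ → E → E}

theorem neg (h : IsDriftFrame f m e) : IsDriftFrame f m (-e) where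
  ne_zero := h.ne_zero
  le_add w := by simpa [sub_eq_add_neg] using h.le_sub w
  le_sub w := by simpa using h.le_add w
  orthogonal := by simpa using h.orthogonal
  apply_eq a s hs := by simpa using h.apply_eq (-a) s hs
  exists_eq y hy := by
    obtain ⟨a, ha⟩ := h.exists_eq y hy
    exact ⟨-a, by simpa using ha⟩

theorem flow_smul (h : IsDriftFrame f m e) (hS : IsGradientFlow f S) {s t : ℝ} (hs : 0 ≤ s)
    (ht : 0 ≤ t) : S t (s • m) = (s + t) • m := by
  rw [hS.eq_segment ht (p := m), add_smul]
  intro r hr w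
  have h1 := h.apply_eq 0 (s + r) (by linarith [hr.1])
  rw [zero_smul, zero_add, abs_zero, zero_mul, sub_zero, add_smul] at h1
  have h2 := h.le_add w
  have h3 := h.le_sub w
  rw [h1, inner_sub_right, inner_add_right, real_inner_smul_right, real_inner_smul_right,
    real_inner_self_eq_norm_sq]
  rw [inner_add_left] at h2
  rw [inner_sub_left] at h3
  linarith

theorem flow_zero (h : IsDriftFrame f m e) (hS : IsGradientFlow f S) {t : ℝ} (ht : 0 ≤ t) :
    S t 0 = t • m := by
  simpa using h.flow_smul hS le_rfl ht

/-- The flow is nonexpansive and moves `l • m` to `(l + t) • m`. Comparing `y` with this point as `l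
→ ∞` turns distances into the linear function `⟪m, ·⟫`, as for a Busemann function. -/
theorem le_inner_flow (h : IsDriftFrame f m e) (hS : IsGradientFlow f S) {t : ℝ} (ht : 0 ≤ t)
    (y : E) : inner ℝ m y + t * ‖m‖ ^ 2 ≤ inner ℝ m (S t y) := by
  by_contra! hlt
  set D := inner ℝ m y + t * ‖m‖ ^ 2 - inner ℝ m (S t y) with hD
  have hDpos : 0 < D := by linarith
  set A := ‖S t y - t • m‖ ^ 2 - ‖y‖ ^ 2 with hA
  have key : ∀ l : ℝ, 0 ≤ l → A + 2 * l * D ≤ 0 := by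
    intro l hl
    have h1 := hS.norm_sub_le ht y (l • m)
    rw [h.flow_smul hS hl ht] at h1
    have h2 : ‖S t y - (l + t) • m‖ ^ 2 ≤ ‖y - l • m‖ ^ 2 := by gcongr
    have h3 : S t y - (l + t) • m = (S t y - t • m) - l • m := by module
    rw [h3, norm_sub_sq_real (S t y - t • m), norm_sub_sq_real y, inner_sub_left,
      real_inner_smul_right, real_inner_smul_right, real_inner_smul_right, real_inner_smul_left,
      real_inner_self_eq_norm_sq, real_inner_comm m, real_inner_comm m] at h2
    linarith
  have h1 := key (|A| / D + 1) (by positivity)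
  have h2 : |A| / D * D = |A| := div_mul_cancel₀ _ hDpos.ne'
  nlinarith [neg_abs_le A, abs_nonneg A]

theorem inner_flow_smul_of_nonneg (h : IsDriftFrame f m e) (hS : IsGradientFlow f S)
    {a t : ℝ} (ha : 0 ≤ a) (ht : 0 ≤ t) : inner ℝ m (S t (a • e)) = t * ‖m‖ ^ 2 := by
  -- From `a • e` the orbit moves with velocity `m - e`, hits the ray at `a • m` at time `a`, then
  -- follows it with velocity `m`. Both velocities have `m`-component `‖m‖²`.
  have hpath : ∀ s, 0 ≤ s → s ≤ a → S s (a • e) = a • e + s • (m - e) := by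
    intro s hs hsa
    refine hS.eq_segment hs fun r hr w => ?_
    have h1 := h.apply_eq (a - r) r hr.1.le
    rw [abs_of_nonneg (by linarith [hr.2])] at h1
    have h2 : a • e + r • (m - e) = (a - r) • e + r • m := by module
    rw [h2, h1, inner_sub_right, inner_add_right, real_inner_smul_right, real_inner_smul_right,
      inner_sub_left m e e, inner_sub_left m e m, real_inner_self_eq_norm_sq,
      real_inner_self_eq_norm_sq, real_inner_comm m e, h.orthogonal]
    linarith [h.le_sub w]
  rcases le_total t a with hta | hta
  · rw [hpath t ht hta, inner_add_right, real_inner_smul_right, real_inner_smul_right,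
      inner_sub_right, real_inner_self_eq_norm_sq, h.orthogonal]
    ring
  · have h1 : S t (a • e) = t • m := by
      have h2 : a • e + a • (m - e) = a • m := by module
      rw [← add_sub_cancel a t, hS.map_add ha (by linarith), hpath a ha le_rfl, h2,
        h.flow_smul hS ha (by linarith)]
    rw [h1, real_inner_smul_right, real_inner_self_eq_norm_sq]

theorem inner_flow_of_inner_eq_zero (h : IsDriftFrame f m e) (hS : IsGradientFlow f S) {t : ℝ}
    (ht : 0 ≤ t) {y : E} (hy : inner ℝ m y = 0) : inner ℝ m (S t y) = t * ‖m‖ ^ 2 := by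
  obtain ⟨a, rfl⟩ := h.exists_eq y hy
  rcases le_total 0 a with ha | ha
  · exact h.inner_flow_smul_of_nonneg hS ha ht
  · have := h.neg.inner_flow_smul_of_nonneg hS (a := -a) (by linarith) ht
    simpa using this

/-- By `le_inner_flow` the start has `⟪m, y⟫ ≤ 0`. If it were negative, the orbit would cross the
line `⟪m, ·⟫ = 0` at some time `s > 0`, and from there only `(t - s) * ‖m‖²` can be gained, short of
`t * ‖m‖²`. -/
theorem inner_eq_zero_of_flow_eq (h : IsDriftFrame f m e) (hS : IsGradientFlow f S) {t : ℝ}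
    (ht : 0 < t) {y : E} (hy : S t y = t • m) : inner ℝ m y = 0 := by
  have hm : 0 < ‖m‖ ^ 2 := by
    have := norm_pos_iff.mpr h.ne_zero
    positivity
  have h1 := h.le_inner_flow hS ht.le y
  have hmt : inner ℝ m (S t y) = t * ‖m‖ ^ 2 := by
    rw [hy, real_inner_smul_right, real_inner_self_eq_norm_sq]
  refine le_antisymm (by linarith) ?_
  by_contra! hneg
  have hcont : ContinuousOn (fun s => (inner ℝ m (S s y) : ℝ)) (Icc 0 t) :=
    continuousOn_const.inner ((hS.continuousOn_time y).mono Icc_subset_Ici_self)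
  have hivt := intermediate_value_Icc ht.le hcont
  obtain ⟨s, hs, hs0⟩ := hivt (show (0 : ℝ) ∈ Icc _ _ by
    rw [hS.map_zero, hmt]
    exact ⟨hneg.le, by positivity⟩)
  have h2 : inner ℝ m (S t y) = (t - s) * ‖m‖ ^ 2 := by
    rw [← h.inner_flow_of_inner_eq_zero hS (sub_nonneg.mpr hs.2) hs0,
      ← hS.map_add hs.1 (sub_nonneg.mpr hs.2), add_sub_cancel]
  have hs00 : s = 0 := by
    have : s * ‖m‖ ^ 2 = 0 := by linarith
    exact (mul_eq_zero.mp this).resolve_right hm.ne'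
  rw [hs00] at hs0
  simp only [hS.map_zero] at hs0
  linarith

variable [FiniteDimensional ℝ E] [MeasurableSpace E] [BorelSpace E] (μ : Measure E)
  [μ.IsAddHaarMeasure]

open Pointwise in
/-- A fibre of positive measure moves with the flow and rescales to fibres at the original time;
since only countably many of those have positive measure, its base point moves radially. -/
theorem flow_eq_smul_of_measure_pos (hS : IsGradientFlow f S)
    (hf : ∀ a : ℝ, 0 < a → ∀ x, f (a • x) = a * f x) {s : ℝ} (hs : 0 < s) {x : E}
    (hx : 0 < μ (S s ⁻¹' {x})) {t : ℝ} (ht : 0 ≤ t) : S t x = ((s + t) / s) • x := by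
  have hcount : {z : E | 0 < μ (S s ⁻¹' {z})}.Countable := by
    refine Measure.countable_meas_pos_of_disjoint_iUnion
      (fun z => (hS.continuous hs.le).measurable (measurableSet_singleton z)) ?_
    intro z z' hne
    exact (disjoint_singleton.mpr hne).preimage _
  set g : ℝ → E := fun t => (s / (s + t)) • S t x with hg
  have hgc : ContinuousOn g (Ici 0) := by
    refine ContinuousOn.smul ?_ (hS.continuousOn_time x)
    refine continuousOn_const.div (by fun_prop) fun t ht => ?_
    have : (0 : ℝ) ≤ t := ht
    positivity
  have hgpos : g '' Ici 0 ⊆ {z : E | 0 < μ (S s ⁻¹' {z})} := by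
    rintro _ ⟨t, ht, rfl⟩
    have ht' : (0 : ℝ) ≤ t := ht
    have ha : 0 < s / (s + t) := by positivity
    have hsub : (s / (s + t)) • (S s ⁻¹' {x}) ⊆ S s ⁻¹' {g t} := by
      rintro _ ⟨y, hy, rfl⟩
      have hy' : S s y = x := hy
      have h1 := hS.map_smul hf ha (t := s + t) (by positivity) y
      rw [div_mul_cancel₀ _ (by positivity), hS.map_add hs.le ht', hy'] at h1
      exact h1
    refine lt_of_lt_of_le ?_ (measure_mono hsub)
    rw [Measure.addHaar_smul]
    refine ENNReal.mul_pos ?_ hx.ne'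
    simp only [ne_eq, ENNReal.ofReal_eq_zero, not_le]
    positivity
  -- A connected image inside a countable set is a point.
  have hsubs : (g '' Ici 0).Subsingleton :=
    hcount.isTotallyDisconnected _ hgpos (isPreconnected_Ici.image g hgc)
  have h1 : g t = g 0 := hsubs ⟨t, ht, rfl⟩ ⟨0, by simp, rfl⟩
  simp only [hg, add_zero, div_self hs.ne', one_smul, hS.map_zero] at h1
  nth_rewrite 2 [← h1]
  rw [smul_smul, div_mul_div_cancel₀ hs.ne', div_self (by positivity), one_smul]

theorem measure_flow_fiber_eq_zero (h : IsDriftFrame f m e) (hS : IsGradientFlow f S)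
    (hf : ∀ a : ℝ, 0 < a → ∀ x, f (a • x) = a * f x) {s : ℝ} (hs : 0 < s) (x : E) :
    μ (S s ⁻¹' {x}) = 0 := by
  by_contra hne
  have hx : ∀ {t : ℝ}, 0 ≤ t → S t x = ((s + t) / s) • x := fun ht =>
    flow_eq_smul_of_measure_pos μ hS hf hs (pos_iff_ne_zero.mpr hne) ht
  have hxm : x = s • m := by
    -- The orbit of `x` stays within `‖x‖` of the orbit `t • m` of the origin, so the two asymptotic
    -- velocities `s⁻¹ • x` and `m` agree.
    have hbd : ∀ t : ℝ, 0 ≤ t → t * ‖x - s • m‖ ≤ s * (‖x‖ + ‖x‖) := by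
      intro t ht
      have h1 := hS.norm_sub_le ht x 0
      rw [hx ht, h.flow_zero hS ht, sub_zero] at h1
      have h2 : t • (x - s • m) = s • ((((s + t) / s) • x - t • m) - x) := by
        rw [smul_sub s, smul_sub s, smul_smul, mul_div_cancel₀ _ hs.ne']
        module
      have h3 := congrArg norm h2
      rw [norm_smul, norm_smul, Real.norm_of_nonneg ht, Real.norm_of_nonneg hs.le] at h3
      rw [h3]
      gcongr
      exact (norm_sub_le _ _).trans (by gcongr)
    by_contra hne'
    have hpos : 0 < ‖x - s • m‖ := norm_pos_iff.mpr (sub_ne_zero.mpr hne')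
    have h1 := hbd (s * (‖x‖ + ‖x‖) / ‖x - s • m‖ + 1) (by positivity)
    rw [add_mul, div_mul_cancel₀ _ hpos.ne'] at h1
    linarith
  have hker : S s ⁻¹' {x} ⊆ (LinearMap.ker (innerₛₗ ℝ m) : Set E) := by
    intro y hy
    have hy' : S s y = x := hy
    exact h.inner_eq_zero_of_flow_eq hS hs (hy'.trans hxm)
  have htop : LinearMap.ker (innerₛₗ ℝ m) ≠ ⊤ := by
    intro htop
    have : m ∈ LinearMap.ker (innerₛₗ ℝ m) := htop ▸ Submodule.mem_top
    exact h.ne_zero (inner_self_eq_zero.mp (LinearMap.mem_ker.mp this))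
  exact hne (measure_mono_null hker (Measure.addHaar_submodule μ _ htop))

end IsDriftFrame

end Drift

/-! ### A drift frame when the circumcenter is outside the triangle. -/

section Obtuse

variable {b : Fin 3 → EuclideanSpace ℝ (Fin 2)}

theorem exists_eq_smul_of_inner_eq_zero {m e y : EuclideanSpace ℝ (Fin 2)} (hm : m ≠ 0)
    (he : e ≠ 0) (hme : inner ℝ m e = 0) (hmy : inner ℝ m y = 0) : ∃ a : ℝ, y = a • e := by
  have hfin : Module.finrank ℝ (ℝ ∙ m)ᗮ = 1 :=
    have : Fact (Module.finrank ℝ (EuclideanSpace ℝ (Fin 2)) = 1 + 1) := ⟨by simp⟩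
    Submodule.finrank_orthogonal_span_singleton hm
  have he' : e ∈ (ℝ ∙ m)ᗮ := Submodule.mem_orthogonal_singleton_iff_inner_right.mpr hme
  have hy' : y ∈ (ℝ ∙ m)ᗮ := Submodule.mem_orthogonal_singleton_iff_inner_right.mpr hmy
  obtain ⟨a, ha⟩ := exists_smul_eq_of_finrank_eq_one hfin
    (x := (⟨e, he'⟩ : (ℝ ∙ m)ᗮ)) (by simpa using he) ⟨y, hy'⟩
  exact ⟨a, by simpa using (congrArg Subtype.val ha).symm⟩

/-- The vertex `k` with negative barycentric weight is discarded: `m` is the midpoint of the other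
two and `e` half their difference, orthogonal because their norms agree. -/
theorem exists_isDriftFrame {R : ℝ} (hR : ∀ i, ‖b i‖ = R) (hinj : Function.Injective b)
    {c : Fin 3 → ℝ} (hc1 : ∑ i, c i = 1) (hc0 : ∑ i, c i • b i = 0)
    (h0 : (0 : EuclideanSpace ℝ (Fin 2)) ∉ convexHull ℝ (range b)) {k : Fin 3} (hk : c k < 0) :
    ∃ m e, IsDriftFrame (threeSector b) m e := by
  obtain ⟨i, j, hik, hjk, hij, hall, hsum⟩ : ∃ i j : Fin 3, i ≠ k ∧ j ≠ k ∧ i ≠ j ∧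
      (∀ l, l = i ∨ l = j ∨ l = k) ∧ (Finset.univ : Finset (Fin 3)) = {i, j, k} := by
    refine ⟨k + 1, k + 2, ?_⟩
    fin_cases k <;> decide
  rw [hsum, Finset.sum_insert (by simp [hij, hik]), Finset.sum_pair hjk] at hc1 hc0
  set m : EuclideanSpace ℝ (Fin 2) := (2⁻¹ : ℝ) • (b i + b j) with hm
  set e : EuclideanSpace ℝ (Fin 2) := (2⁻¹ : ℝ) • (b i - b j) with he
  have hbi : b i = m + e := by rw [hm, he]; module
  have hbj : b j = m - e := by rw [hm, he]; module
  have hme : inner ℝ m e = 0 := by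
    rw [hm, he, real_inner_smul_left, real_inner_smul_right, inner_add_left, inner_sub_right,
      inner_sub_right, real_inner_self_eq_norm_sq, real_inner_self_eq_norm_sq, hR, hR,
      real_inner_comm (b i)]
    ring
  have hem : inner ℝ e m = 0 := by rw [real_inner_comm, hme]
  clear_value m e
  have hm0 : m ≠ 0 := by
    intro hm0
    apply h0
    rw [← hm0, hm, smul_add]
    exact (convex_convexHull ℝ (range b)) (subset_convexHull ℝ _ (mem_range_self i))
      (subset_convexHull ℝ _ (mem_range_self j)) (by norm_num) (by norm_num) (by norm_num)
  have he0 : e ≠ 0 := by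
    intro he0
    apply hij
    apply hinj
    rw [hbi, hbj, he0, add_zero, sub_zero]
  have hmpos : 0 < ‖m‖ ^ 2 := by
    have := norm_pos_iff.mpr hm0
    positivity
  have hepos : 0 < ‖e‖ ^ 2 := by
    have := norm_pos_iff.mpr he0
    positivity
  obtain ⟨g, β, hg, hbk⟩ : ∃ g β : ℝ, 0 < g ∧ b k = (1 + g) • m + β • e := by
    refine ⟨(-c k)⁻¹, (c i - c j) / (-c k), inv_pos.mpr (by linarith), ?_⟩
    have hck : -c k ≠ 0 := by linarith
    have h1 : (-c k) • b k = (c i + c j) • m + (c i - c j) • e := by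
      rw [hbi, hbj] at hc0
      have : (-c k) • b k = c i • (m + e) + c j • (m - e)
          - (c i • (m + e) + (c j • (m - e) + c k • b k)) := by module
      rw [this, hc0]
      module
    have h2 : b k = (-c k)⁻¹ • ((-c k) • b k) := by rw [smul_smul, inv_mul_cancel₀ hck, one_smul]
    rw [h2, h1, smul_add, smul_smul, smul_smul, show c i + c j = 1 + -c k by linarith]
    rw [mul_add, mul_one, inv_mul_cancel₀ hck, add_comm _ (1 : ℝ), div_eq_inv_mul]
  -- From `‖b k‖ = ‖b i‖`, that is `(1 + g)² ‖m‖² + β² ‖e‖² = ‖m‖² + ‖e‖²` with `g > 0`. With `|β| ≤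
  -- 1` the form `b k` is never below both others where `s ≥ 0`.
  have hβ : |β| ≤ 1 := by
    have h1 : ‖b i‖ ^ 2 = ‖m‖ ^ 2 + ‖e‖ ^ 2 := by
      rw [hbi, norm_add_sq_real, hme]
      ring
    have h2 : ‖b k‖ ^ 2 = (1 + g) ^ 2 * ‖m‖ ^ 2 + β ^ 2 * ‖e‖ ^ 2 := by
      rw [hbk, norm_add_sq_real, real_inner_smul_left, real_inner_smul_right, hme, norm_smul,
        norm_smul, mul_pow, mul_pow, Real.norm_eq_abs, Real.norm_eq_abs, sq_abs, sq_abs]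
      ring
    rw [hR] at h1 h2
    have h3 : β ^ 2 * ‖e‖ ^ 2 ≤ 1 * ‖e‖ ^ 2 := by nlinarith [mul_pos hg hmpos, sq_nonneg g]
    have h4 := le_of_mul_le_mul_right h3 hepos
    exact abs_le_one_iff_mul_self_le_one.mpr (by nlinarith)
  refine ⟨m, e, hm0, fun w => hbi ▸ threeSector_le w i, fun w => hbj ▸ threeSector_le w j, hme,
    fun a s hs => ?_, fun y hy => exists_eq_smul_of_inner_eq_zero hm0 he0 hme hy⟩
  have hi : inner ℝ (b i) (a • e + s • m) = s * ‖m‖ ^ 2 + a * ‖e‖ ^ 2 := by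
    simp only [hbi, inner_add_left, inner_add_right, real_inner_smul_right, hme, hem,
      real_inner_self_eq_norm_sq]
    ring
  have hj : inner ℝ (b j) (a • e + s • m) = s * ‖m‖ ^ 2 - a * ‖e‖ ^ 2 := by
    simp only [hbj, inner_sub_left, inner_add_right, real_inner_smul_right, hme, hem,
      real_inner_self_eq_norm_sq]
    ring
  have hkk : inner ℝ (b k) (a • e + s • m) = (1 + g) * (s * ‖m‖ ^ 2) + (β * a) * ‖e‖ ^ 2 := by
    simp only [hbk, inner_add_left, inner_add_right, real_inner_smul_right, real_inner_smul_left,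
      hme, hem, real_inner_self_eq_norm_sq]
    ring
  apply le_antisymm
  · rcases le_total 0 a with ha | ha
    · rw [abs_of_nonneg ha, ← hj]
      exact threeSector_le _ j
    · rw [abs_of_nonpos ha, neg_mul, sub_neg_eq_add, ← hi]
      exact threeSector_le _ i
  · refine le_threeSector fun l => ?_
    rcases hall l with rfl | rfl | rfl
    · rw [hi]
      nlinarith [neg_abs_le a]
    · rw [hj]
      nlinarith [le_abs_self a]
    · rw [hkk]
      have h1 : -|a| ≤ β * a := by
        have : |β * a| ≤ |a| := by
          rw [abs_mul]
          exact mul_le_of_le_one_left (abs_nonneg a) hβ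
        linarith [neg_abs_le (β * a)]
      have h2 := mul_le_mul_of_nonneg_right h1 hepos.le
      have h3 : 0 ≤ g * (s * ‖m‖ ^ 2) := by positivity
      linarith

end Obtuse

/-! ### Gaussian integrals. -/

section Gaussian

variable {d : ℕ}

local notation "𝔼" => EuclideanSpace ℝ (Fin d)

theorem integrable_exp_neg_mul_norm_sq {β : ℝ} (hβ : 0 < β) :
    Integrable (fun z : 𝔼 => Real.exp (-β * ‖z‖ ^ 2)) := by
  have h := (GaussianFourier.integrable_cexp_neg_mul_sq_norm_add (V := 𝔼) (b := (β : ℂ))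
    (by simpa using hβ) 0 0).norm
  refine h.congr (Eventually.of_forall fun z => ?_)
  simp only [Complex.norm_exp]
  congr 1
  simp [← Complex.ofReal_pow]

theorem integrable_one_add_norm_mul_exp {β : ℝ} (hβ : 0 < β) (a : ℝ) :
    Integrable (fun z : 𝔼 => (1 + ‖z‖) * Real.exp (-β * ‖z‖ ^ 2 + a * ‖z‖)) := by
  have h := (integrable_exp_neg_mul_norm_sq (d := d) (half_pos hβ)).const_mul
    (Real.exp ((1 + a) ^ 2 / (2 * β)))
  refine h.mono' (by fun_prop) (Eventually.of_forall fun z => ?_)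
  rw [Real.norm_of_nonneg (by positivity), ← Real.exp_add]
  calc (1 + ‖z‖) * Real.exp (-β * ‖z‖ ^ 2 + a * ‖z‖)
      ≤ Real.exp ‖z‖ * Real.exp (-β * ‖z‖ ^ 2 + a * ‖z‖) := by
        gcongr
        linarith [Real.add_one_le_exp ‖z‖]
    _ = Real.exp (‖z‖ + (-β * ‖z‖ ^ 2 + a * ‖z‖)) := (Real.exp_add _ _).symm
    _ ≤ _ := by
        rw [Real.exp_le_exp]
        have h1 : (1 + a) ^ 2 / (2 * β) - ((1 + a) * ‖z‖ - β / 2 * ‖z‖ ^ 2)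
            = (1 + a - β * ‖z‖) ^ 2 / (2 * β) := by
          field_simp
          ring
        have h2 : 0 ≤ (1 + a - β * ‖z‖) ^ 2 / (2 * β) := by positivity
        linarith

theorem integrable_exp_neg_norm_sq_add {β : ℝ} (hβ : 0 < β) (a : ℝ) :
    Integrable (fun z : 𝔼 => Real.exp (-β * ‖z‖ ^ 2 + a * ‖z‖)) := by
  refine (integrable_one_add_norm_mul_exp hβ a).mono' (by fun_prop)
    (Eventually.of_forall fun z => ?_)
  rw [Real.norm_of_nonneg (by positivity)]
  exact le_mul_of_one_le_left (by positivity) (by linarith [norm_nonneg z])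

theorem integrable_norm_mul_exp {β : ℝ} (hβ : 0 < β) (a : ℝ) :
    Integrable (fun z : 𝔼 => ‖z‖ * Real.exp (-β * ‖z‖ ^ 2 + a * ‖z‖)) := by
  refine (integrable_one_add_norm_mul_exp hβ a).mono' (by fun_prop)
    (Eventually.of_forall fun z => ?_)
  rw [Real.norm_of_nonneg (by positivity)]
  gcongr
  linarith

theorem integral_exp_neg_norm_sub_sq_sub_inner {σ ε : ℝ} (hσ : 0 < σ) (v x : 𝔼) :
    ∫ y, Real.exp (-‖x - y‖ ^ 2 / (2 * σ) - inner ℝ v y / ε) =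
      (2 * Real.pi * σ) ^ ((d : ℝ) / 2) *
        Real.exp (σ * ‖v‖ ^ 2 / (2 * ε ^ 2) - inner ℝ v x / ε) := by
  have h1 : ∀ y : 𝔼, Real.exp (-‖x - y‖ ^ 2 / (2 * σ) - inner ℝ v y / ε) =
      Real.exp (σ * ‖v‖ ^ 2 / (2 * ε ^ 2) - inner ℝ v x / ε) *
        Real.exp (-(1 / (2 * σ)) * ‖(x - (σ / ε) • v) - y‖ ^ 2) := by
    intro y
    rw [← Real.exp_add]
    congr 1
    have h2 : (x - (σ / ε) • v) - y = (x - y) - (σ / ε) • v := by abel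
    rw [h2, norm_sub_sq_real (x - y), norm_smul, mul_pow, Real.norm_eq_abs, sq_abs,
      real_inner_smul_right, inner_sub_left, real_inner_comm v, real_inner_comm v]
    -- With `ε = 0` every quotient by `ε` is `0` by convention and the identity still holds.
    by_cases hε : ε = 0
    · simp only [hε, div_zero, zero_mul]
      field_simp
      ring
    · field_simp
      ring
  simp only [h1]
  rw [integral_const_mul, integral_sub_left_eq_self
    (fun y : 𝔼 => Real.exp (-(1 / (2 * σ)) * ‖y‖ ^ 2)),
    GaussianFourier.integral_rexp_neg_mul_sq_norm (by positivity), finrank_euclideanSpace_fin,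
    mul_comm]
  congr 2
  field_simp

end Gaussian

/-! ### Differentiability and concavity of the Cole–Hopf potential. -/

section HeatKernel

variable {d : ℕ} {φ : EuclideanSpace ℝ (Fin d) → ℝ} {L : NNReal} {ε : ℝ}

local notation "𝔼" => EuclideanSpace ℝ (Fin d)

/-- The Gaussian average in the Cole-Hopf formula, before normalisation. -/
def heatIntegral (φ : EuclideanSpace ℝ (Fin d) → ℝ) (ε t : ℝ) (x : EuclideanSpace ℝ (Fin d)) : ℝ :=
  ∫ y, Real.exp (-‖x - y‖ ^ 2 / (2 * ε * t) - φ y / ε)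

theorem neg_div_le_of_lipschitz (hφ : LipschitzWith L φ) (hε : 0 < ε) (x y : 𝔼) :
    -φ y / ε ≤ -φ x / ε + L / ε * ‖x - y‖ := by
  have h := hφ.dist_le_mul x y
  rw [Real.dist_eq, dist_eq_norm] at h
  have h1 := (abs_le.mp h).2
  rw [← sub_nonneg]
  have : -φ x / ε + L / ε * ‖x - y‖ - -φ y / ε = (L * ‖x - y‖ - (φ x - φ y)) / ε := by
    ring
  rw [this]
  exact div_nonneg (by linarith) hε.le

theorem integrable_heatKernel (hφ : LipschitzWith L φ) (hε : 0 < ε) {t : ℝ} (ht : 0 < t) (x : 𝔼) :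
    Integrable (fun y => Real.exp (-‖x - y‖ ^ 2 / (2 * ε * t) - φ y / ε)) := by
  have hcont := hφ.continuous
  have h := ((integrable_exp_neg_norm_sq_add (d := d) (β := 1 / (2 * ε * t)) (by positivity)
    (L / ε)).comp_sub_left x).const_mul (Real.exp (-φ x / ε))
  refine h.mono' (by fun_prop) (Eventually.of_forall fun y => ?_)
  rw [Real.norm_of_nonneg (by positivity), ← Real.exp_add]
  gcongr
  have h1 := neg_div_le_of_lipschitz hφ hε x y
  rw [neg_div, neg_div] at *
  have : ‖x - y‖ ^ 2 / (2 * ε * t) = 1 / (2 * ε * t) * ‖x - y‖ ^ 2 := by ring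
  linarith

theorem heatIntegral_pos (hφ : LipschitzWith L φ) (hε : 0 < ε) {t : ℝ} (ht : 0 < t) (x : 𝔼) :
    0 < heatIntegral φ ε t x :=
  integral_exp_pos (integrable_heatKernel hφ hε ht x)

theorem hasGradientAt_heatIntegral (hφ : LipschitzWith L φ) (hε : 0 < ε) {t : ℝ} (ht : 0 < t)
    (x : 𝔼) :
    HasGradientAt (heatIntegral φ ε t)
      (∫ y, (-(ε * t)⁻¹ * Real.exp (-‖x - y‖ ^ 2 / (2 * ε * t) - φ y / ε)) • (x - y)) x := by
  have hcont := hφ.continuous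
  set σ := ε * t with hσ
  have hσpos : 0 < σ := by positivity
  have h2σ : 2 * ε * t = 2 * σ := by rw [hσ]; ring
  simp only [h2σ]
  unfold heatIntegral
  simp only [h2σ]
  set F' : 𝔼 → 𝔼 → 𝔼 →L[ℝ] ℝ := fun x y =>
    (-σ⁻¹ * Real.exp (-‖x - y‖ ^ 2 / (2 * σ) - φ y / ε)) • innerSL ℝ (x - y) with hF'
  set bound : 𝔼 → ℝ := fun y => σ⁻¹ * Real.exp (1 / (2 * σ) - φ x / ε) *
    ((1 + ‖x - y‖) * Real.exp (-(1 / (4 * σ)) * ‖x - y‖ ^ 2 + L / ε * ‖x - y‖)) with hbound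
  have hb_int : Integrable bound :=
    ((integrable_one_add_norm_mul_exp (d := d) (β := 1 / (4 * σ)) (by positivity)
      (L / ε)).comp_sub_left x).const_mul _
  have hF'_le : ∀ y, ∀ x' ∈ Metric.ball x 1, ‖F' x' y‖ ≤ bound y := by
    intro y x' hx'
    have hx'' : ‖x - x'‖ < 1 := by rwa [← dist_eq_norm, dist_comm]
    have hb1 : ‖x' - y‖ ≤ 1 + ‖x - y‖ := by
      have : x' - y = (x - y) - (x - x') := by abel
      rw [this]
      linarith [norm_sub_le (x - y) (x - x')]
    have hb2 : ‖x - y‖ ≤ 1 + ‖x' - y‖ := by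
      have : x - y = (x' - y) + (x - x') := by abel
      rw [this]
      linarith [norm_add_le (x' - y) (x - x')]
    -- Halving the Gaussian rate, from `1 / (2 * σ)` to `1 / (4 * σ)`, buys a bound uniform over the
    -- unit ball around `x`.
    have hb3 : ‖x - y‖ ^ 2 ≤ 2 * ‖x' - y‖ ^ 2 + 2 := by
      nlinarith [norm_nonneg (x - y), norm_nonneg (x' - y), sq_nonneg (‖x' - y‖ - 1)]
    rw [hF', hbound]
    simp only [norm_smul, innerSL_apply_norm, norm_mul, norm_neg]
    rw [Real.norm_of_nonneg (by positivity), Real.norm_of_nonneg (by positivity)]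
    have h1 := neg_div_le_of_lipschitz hφ hε x y
    have hexp : Real.exp (-‖x' - y‖ ^ 2 / (2 * σ) - φ y / ε) ≤
        Real.exp (1 / (2 * σ) - φ x / ε) *
          Real.exp (-(1 / (4 * σ)) * ‖x - y‖ ^ 2 + L / ε * ‖x - y‖) := by
      rw [← Real.exp_add]
      gcongr
      have h3 : 0 ≤ (2 * ‖x' - y‖ ^ 2 + 2 - ‖x - y‖ ^ 2) / (4 * σ) :=
        div_nonneg (by linarith) (by positivity)
      have h4 : (2 * ‖x' - y‖ ^ 2 + 2 - ‖x - y‖ ^ 2) / (4 * σ) =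
          ‖x' - y‖ ^ 2 / (2 * σ) + 1 / (2 * σ) - 1 / (4 * σ) * ‖x - y‖ ^ 2 := by
        field_simp
        ring
      rw [neg_div, neg_div] at *
      linarith
    calc σ⁻¹ * Real.exp (-‖x' - y‖ ^ 2 / (2 * σ) - φ y / ε) * ‖x' - y‖
        ≤ σ⁻¹ * (Real.exp (1 / (2 * σ) - φ x / ε) *
          Real.exp (-(1 / (4 * σ)) * ‖x - y‖ ^ 2 + L / ε * ‖x - y‖)) * (1 + ‖x - y‖) := by
          gcongr
      _ = _ := by ring
  have hmeas : AEStronglyMeasurable (F' x) volume := by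
    refine Continuous.aestronglyMeasurable ?_
    rw [hF']
    fun_prop
  have hF'int : Integrable (F' x) := by
    refine hb_int.mono' hmeas (Eventually.of_forall fun y => ?_)
    exact hF'_le y x (Metric.mem_ball_self one_pos)
  have hint := integrable_heatKernel hφ hε ht x
  rw [h2σ] at hint
  have key := hasFDerivAt_integral_of_dominated_of_fderiv_le (μ := (volume : Measure 𝔼))
    (F := fun x y => Real.exp (-‖x - y‖ ^ 2 / (2 * σ) - φ y / ε)) (F' := F') (x₀ := x)
    (bound := bound) (Metric.ball_mem_nhds x one_pos)
    (Eventually.of_forall fun x' => by fun_prop) hint hmeas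
    (Eventually.of_forall fun y => hF'_le y) hb_int
    (Eventually.of_forall fun y x' _ => by
      have h1 : HasFDerivAt (fun x : 𝔼 => ‖x - y‖ ^ 2) (2 • innerSL ℝ (x' - y)) x' := by
        simpa using ((hasFDerivAt_id x').sub_const y).norm_sq
      have h2 : HasFDerivAt (fun x : 𝔼 => -‖x - y‖ ^ 2 / (2 * σ) - φ y / ε)
          (-(2 * σ)⁻¹ • (2 • innerSL ℝ (x' - y))) x' := by
        have := (h1.const_smul (-(2 * σ)⁻¹)).sub_const (φ y / ε)
        refine this.congr_of_eventuallyEq (Eventually.of_forall fun x => ?_)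
        simp only [smul_eq_mul, Pi.smul_apply]
        ring
      refine h2.exp.congr_fderiv ?_
      rw [hF']
      ext w
      simp only [smul_apply, innerSL_apply_apply, smul_eq_mul, nsmul_eq_mul]
      field_simp
      norm_num)
  rw [hasGradientAt_iff_hasFDerivAt]
  refine key.congr_fderiv ?_
  symm
  ext w
  rw [ContinuousLinearMap.integral_apply hF'int, InnerProductSpace.toDual_apply_apply,
    real_inner_comm, ← integral_inner]
  · refine integral_congr_ae (Eventually.of_forall fun y => ?_)
    simp only [hF', smul_apply, innerSL_apply_apply, smul_eq_mul,
      real_inner_smul_right]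
    rw [real_inner_comm]
  · refine hb_int.mono' (Continuous.aestronglyMeasurable (by fun_prop))
      (Eventually.of_forall fun y => ?_)
    refine le_of_eq_of_le ?_ (hF'_le y x (Metric.mem_ball_self one_pos))
    simp only [hF', norm_smul, innerSL_apply_norm]

theorem hasGradientAt_viscousPotential (hφ : LipschitzWith L φ) (hε : 0 < ε) {t : ℝ} (ht : 0 < t)
    (x : 𝔼) :
    HasGradientAt (viscousPotential φ ε t) ((heatIntegral φ ε t x)⁻¹ •
      ∫ y, (t⁻¹ * Real.exp (-‖x - y‖ ^ 2 / (2 * ε * t) - φ y / ε)) • (x - y)) x := by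
  have hpos := heatIntegral_pos hφ hε ht x
  have hc : (1 / (2 * Real.pi * ε * t) ^ ((d : ℝ) / 2)) ≠ 0 := by
    have : 0 < 2 * Real.pi * ε * t := by positivity
    positivity
  have h1 := (hasGradientAt_heatIntegral hφ hε ht x).hasFDerivAt
  have h2 := ((h1.const_mul (1 / (2 * Real.pi * ε * t) ^ ((d : ℝ) / 2))).log
    (mul_ne_zero hc hpos.ne')).const_mul (-ε)
  rw [hasGradientAt_iff_hasFDerivAt]
  refine h2.congr_fderiv ?_
  symm
  ext w
  have h3 : ∫ y, (-(ε * t)⁻¹ * Real.exp (-‖x - y‖ ^ 2 / (2 * ε * t) - φ y / ε)) • (x - y) =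
      (-ε⁻¹) • ∫ y, (t⁻¹ * Real.exp (-‖x - y‖ ^ 2 / (2 * ε * t) - φ y / ε)) • (x - y) := by
    rw [← integral_smul]
    congr 1
    ext1 y
    rw [smul_smul, mul_inv]
    ring_nf
  rw [h3]
  simp only [InnerProductSpace.toDual_apply_apply, smul_apply, smul_eq_mul,
    real_inner_smul_left]
  have hpos' := hpos.ne'
  have hε' := hε.ne'
  field_simp

/-- Cole-Hopf potentials of concave data are concave. -/
theorem viscousPotential_le_add_inner (hφ : LipschitzWith L φ) (hconc : ConcaveOn ℝ univ φ)
    (hε : 0 < ε) {t : ℝ} (ht : 0 < t) (x w : 𝔼) :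
    viscousPotential φ ε t w ≤ viscousPotential φ ε t x +
      inner ℝ (gradient (viscousPotential φ ε t) x) (w - x) := by
  set H := heatIntegral φ ε t with hH
  have hHpos : ∀ x, 0 < H x := heatIntegral_pos hφ hε ht
  have hshift : ∀ x, H x = ∫ y, Real.exp (-‖y‖ ^ 2 / (2 * ε * t) - φ (x + y) / ε) := by
    intro x
    rw [hH, heatIntegral, ← integral_add_left_eq_self _ x]
    congr 1
    ext1 y
    rw [sub_add_cancel_left, norm_neg]
  have hint : ∀ x, Integrable (fun y => Real.exp (-‖y‖ ^ 2 / (2 * ε * t) - φ (x + y) / ε)) := by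
    intro x
    have := (integrable_heatKernel hφ hε ht x).comp_add_left x
    simpa only [sub_add_cancel_left, norm_neg] using this
  -- Convexity of `log H`, which is Hölder's inequality. It follows from convexity of `exp` once the
  -- integrands at `x` and `w` are normalised to have integral one.
  have hlog : ∀ s ∈ Icc (0 : ℝ) 1,
      Real.log (H (x + s • (w - x))) ≤ (1 - s) * Real.log (H x) + s * Real.log (H w) := by
    intro s hs
    set A := (1 - s) * Real.log (H x) + s * Real.log (H w) with hA
    have hnorm : ∀ x, ∫ y, Real.exp (-‖y‖ ^ 2 / (2 * ε * t) - φ (x + y) / ε - Real.log (H x))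
        = 1 := by
      intro x
      simp only [Real.exp_sub _ (Real.log _), Real.exp_log (hHpos x)]
      rw [integral_div, ← hshift, div_self (hHpos x).ne']
    have hint' : ∀ x, Integrable (fun y =>
        Real.exp (-‖y‖ ^ 2 / (2 * ε * t) - φ (x + y) / ε - Real.log (H x))) := by
      intro x
      simp only [Real.exp_sub _ (Real.log _)]
      exact (hint x).div_const _
    have h1 : ∫ y, Real.exp (-‖y‖ ^ 2 / (2 * ε * t) - φ (x + s • (w - x) + y) / ε - A) ≤
        ∫ y, ((1 - s) * Real.exp (-‖y‖ ^ 2 / (2 * ε * t) - φ (x + y) / ε - Real.log (H x)) +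
          s * Real.exp (-‖y‖ ^ 2 / (2 * ε * t) - φ (w + y) / ε - Real.log (H w))) := by
      refine integral_mono ?_ (((hint' x).const_mul _).add ((hint' w).const_mul _)) fun y => ?_
      · simp only [Real.exp_sub _ A]
        exact (hint _).div_const _
      · have hc1 := convexOn_exp.2
          (mem_univ (-‖y‖ ^ 2 / (2 * ε * t) - φ (x + y) / ε - Real.log (H x)))
          (mem_univ (-‖y‖ ^ 2 / (2 * ε * t) - φ (w + y) / ε - Real.log (H w)))
          (sub_nonneg.mpr hs.2) hs.1 (by ring)
        refine le_trans (Real.exp_le_exp.mpr ?_) hc1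
        have hc2 := hconc.2 (mem_univ (x + y)) (mem_univ (w + y)) (sub_nonneg.mpr hs.2) hs.1
          (by ring)
        have hc3 : (1 - s) • (x + y) + s • (w + y) = x + s • (w - x) + y := by module
        rw [hc3] at hc2
        simp only [smul_eq_mul] at hc2 ⊢
        have hc4 := div_le_div_of_nonneg_right hc2 hε.le
        rw [hA]
        have hc5 : ((1 - s) * φ (x + y) + s * φ (w + y)) / ε
            = (1 - s) * (φ (x + y) / ε) + s * (φ (w + y) / ε) := by ring
        rw [hc5] at hc4
        linarith
    rw [integral_add ((hint' x).const_mul _) ((hint' w).const_mul _), integral_const_mul,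
      integral_const_mul, hnorm, hnorm] at h1
    simp only [Real.exp_sub _ A] at h1
    rw [integral_div, ← hshift, div_le_iff₀ (Real.exp_pos _)] at h1
    rw [Real.log_le_iff_le_exp (hHpos _)]
    linarith
  have hu : ∀ x, viscousPotential φ ε t x =
      -ε * Real.log (1 / (2 * Real.pi * ε * t) ^ ((d : ℝ) / 2)) - ε * Real.log (H x) := by
    intro x
    have hc : (1 / (2 * Real.pi * ε * t) ^ ((d : ℝ) / 2)) ≠ 0 := by
      have : 0 < 2 * Real.pi * ε * t := by positivity
      positivity
    have : viscousPotential φ ε t x =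
      -ε * Real.log (1 / (2 * Real.pi * ε * t) ^ ((d : ℝ) / 2) * H x) := rfl
    rw [this, Real.log_mul hc (hHpos x).ne']
    ring
  have hgrad := (hasGradientAt_viscousPotential hφ hε ht x).differentiableAt.hasGradientAt
  have hline : HasDerivAt (fun s : ℝ => viscousPotential φ ε t (x + s • (w - x)))
      (inner ℝ (gradient (viscousPotential φ ε t) x) (w - x)) 0 := by
    have h1 : HasDerivAt (fun s : ℝ => x + s • (w - x)) (w - x) 0 := by
      simpa using ((hasDerivAt_id (0 : ℝ)).smul_const (w - x)).const_add x
    have h2 := hgrad.hasFDerivAt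
    have h3 : x = x + (0 : ℝ) • (w - x) := by simp
    rw [h3] at h2
    have h4 := h2.comp_hasDerivAt (0 : ℝ) h1
    rw [← h3] at h4
    rw [InnerProductSpace.toDual_apply_apply] at h4
    exact h4
  have hslope := (hasDerivAt_iff_tendsto_slope.mp hline).mono_left
    (nhdsWithin_mono 0 (fun s (hs : 0 < s) => hs.ne') : 𝓝[>] (0 : ℝ) ≤ 𝓝[≠] 0)
  have hle := ge_of_tendsto hslope (b := viscousPotential φ ε t w - viscousPotential φ ε t x) (by
    filter_upwards [Ioo_mem_nhdsGT (zero_lt_one' ℝ)] with s hs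
    rw [slope_def_field, sub_zero, le_div_iff₀ hs.1, zero_smul, add_zero, hu, hu, hu]
    have h1 := mul_le_mul_of_nonneg_left (hlog s ⟨hs.1.le, hs.2.le⟩) hε.le
    nlinarith)
  linarith

end HeatKernel

/-! ### Bounds on the viscous velocity after Gaussian rescaling. -/

section Velocity

variable {d : ℕ} {φ : EuclideanSpace ℝ (Fin d) → ℝ} {L : NNReal} {ε : ℝ}

local notation "𝔼" => EuclideanSpace ℝ (Fin d)

/-- The rescaled Gibbs weight of the Cole-Hopf formula at time `r ^ 2`. -/
def gibbsWeight (φ : EuclideanSpace ℝ (Fin d) → ℝ) (ε r : ℝ) (x z : EuclideanSpace ℝ (Fin d)) : ℝ :=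
  Real.exp (-‖z‖ ^ 2 / 2 - φ (x + (√ε * r) • z) / ε)

/-- The mean of the rescaled Gibbs weight. -/
def gibbsMean (φ : EuclideanSpace ℝ (Fin d) → ℝ) (ε r : ℝ) (x : EuclideanSpace ℝ (Fin d)) :
    EuclideanSpace ℝ (Fin d) :=
  (∫ z, gibbsWeight φ ε r x z)⁻¹ • ∫ z, gibbsWeight φ ε r x z • z

theorem gibbsWeight_pos (r : ℝ) (x z : 𝔼) : 0 < gibbsWeight φ ε r x z := Real.exp_pos _

theorem continuous_gibbsWeight (hφ : Continuous φ) (r : ℝ) (x : 𝔼) :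
    Continuous (gibbsWeight φ ε r x) := by
  unfold gibbsWeight
  fun_prop

theorem continuous_gibbsWeight_time (hφ : Continuous φ) (x z : 𝔼) :
    Continuous (fun r => gibbsWeight φ ε r x z) := by
  unfold gibbsWeight
  fun_prop

theorem gibbsWeight_le (hφ : LipschitzWith L φ) (hε : 0 < ε) {r ρ : ℝ} (hr : r ∈ Icc 0 ρ)
    (x z : 𝔼) : gibbsWeight φ ε r x z ≤
      Real.exp (-φ x / ε) * Real.exp (-(1 / 2) * ‖z‖ ^ 2 + L / ε * (√ε * ρ) * ‖z‖) := by
  rw [gibbsWeight, ← Real.exp_add, Real.exp_le_exp]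
  have h1 := neg_div_le_of_lipschitz hφ hε x (x + (√ε * r) • z)
  have hr0 := hr.1
  have h2 : ‖x - (x + (√ε * r) • z)‖ ≤ √ε * ρ * ‖z‖ := by
    rw [sub_add_cancel_left, norm_neg, norm_smul, Real.norm_of_nonneg (by positivity)]
    gcongr
    exact hr.2
  have h3 : L / ε * ‖x - (x + (√ε * r) • z)‖ ≤ L / ε * (√ε * ρ * ‖z‖) := by gcongr
  rw [neg_div] at *
  linarith

theorem le_gibbsWeight (hφ : LipschitzWith L φ) (hε : 0 < ε) {r ρ : ℝ} (hr : r ∈ Icc 0 ρ)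
    (x z : 𝔼) :
    Real.exp (-φ x / ε) * Real.exp (-(1 / 2) * ‖z‖ ^ 2 + -(L / ε * (√ε * ρ)) * ‖z‖) ≤
      gibbsWeight φ ε r x z := by
  rw [gibbsWeight, ← Real.exp_add, Real.exp_le_exp]
  have h1 := neg_div_le_of_lipschitz hφ hε (x + (√ε * r) • z) x
  have hr0 := hr.1
  have h2 : ‖(x + (√ε * r) • z) - x‖ ≤ √ε * ρ * ‖z‖ := by
    rw [add_sub_cancel_left, norm_smul, Real.norm_of_nonneg (by positivity)]
    gcongr
    exact hr.2
  have h3 : L / ε * ‖(x + (√ε * r) • z) - x‖ ≤ L / ε * (√ε * ρ * ‖z‖) := by gcongr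
  have h4 : -φ (x + (√ε * r) • z) / ε = -(φ (x + (√ε * r) • z) / ε) := neg_div _ _
  linarith

theorem integrable_gibbsWeight (hφ : LipschitzWith L φ) (hε : 0 < ε) {r : ℝ} (hr : 0 ≤ r) (x : 𝔼) :
    Integrable (gibbsWeight φ ε r x) := by
  refine ((integrable_exp_neg_norm_sq_add (d := d) (β := 1 / 2) (by norm_num)
    (L / ε * (√ε * r))).const_mul (Real.exp (-φ x / ε))).mono'
    (continuous_gibbsWeight hφ.continuous r x).aestronglyMeasurable
    (Eventually.of_forall fun z => ?_)
  rw [Real.norm_of_nonneg (gibbsWeight_pos r x z).le]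
  exact gibbsWeight_le hφ hε ⟨hr, le_rfl⟩ x z

theorem norm_gibbsWeight_smul_le (hφ : LipschitzWith L φ) (hε : 0 < ε) {r ρ : ℝ} (hr : r ∈ Icc 0 ρ)
    (x z : 𝔼) : ‖gibbsWeight φ ε r x z • z‖ ≤ Real.exp (-φ x / ε) *
      (‖z‖ * Real.exp (-(1 / 2) * ‖z‖ ^ 2 + L / ε * (√ε * ρ) * ‖z‖)) := by
  rw [norm_smul, Real.norm_of_nonneg (gibbsWeight_pos r x z).le]
  have := mul_le_mul_of_nonneg_right (gibbsWeight_le hφ hε hr x z) (norm_nonneg z)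
  linarith

theorem integrable_gibbsWeight_smul (hφ : LipschitzWith L φ) (hε : 0 < ε) {r : ℝ} (hr : 0 ≤ r)
    (x : 𝔼) : Integrable (fun z => gibbsWeight φ ε r x z • z) :=
  ((integrable_norm_mul_exp (d := d) (β := 1 / 2) (by norm_num)
    (L / ε * (√ε * r))).const_mul (Real.exp (-φ x / ε))).mono'
    ((continuous_gibbsWeight hφ.continuous r x).smul continuous_id).aestronglyMeasurable
    (Eventually.of_forall (norm_gibbsWeight_smul_le hφ hε ⟨hr, le_rfl⟩ x))

theorem integral_gibbsWeight_pos (hφ : LipschitzWith L φ) (hε : 0 < ε) {r : ℝ} (hr : 0 ≤ r)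
    (x : 𝔼) : 0 < ∫ z, gibbsWeight φ ε r x z :=
  integral_exp_pos (integrable_gibbsWeight hφ hε hr x)

/-- The factor `exp (-φ x / ε)` cancels between upper and lower bounds, so `B` is independent of
`x`; this global bound excludes blow-up. -/
theorem exists_gibbs_moment_le (hφ : LipschitzWith L φ) (hε : 0 < ε) (ρ : ℝ) :
    ∃ B : ℝ, 0 ≤ B ∧ ∀ r ∈ Icc 0 ρ, ∀ x,
      ∫ z, ‖gibbsWeight φ ε r x z • z‖ ≤ B * ∫ z, gibbsWeight φ ε r x z := by
  set a := L / ε * (√ε * ρ) with ha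
  set I₁ := ∫ z : 𝔼, ‖z‖ * Real.exp (-(1 / 2) * ‖z‖ ^ 2 + a * ‖z‖) with hI₁
  set I₀ := ∫ z : 𝔼, Real.exp (-(1 / 2) * ‖z‖ ^ 2 + -a * ‖z‖) with hI₀
  have hint₀ := integrable_exp_neg_norm_sq_add (d := d) (β := 1 / 2) (by norm_num) (-a)
  have hint₁ := integrable_norm_mul_exp (d := d) (β := 1 / 2) (by norm_num) a
  have hI₀pos : 0 < I₀ := integral_exp_pos hint₀
  have hI₁nn : 0 ≤ I₁ := integral_nonneg fun z => by positivity
  refine ⟨I₁ / I₀, by positivity, fun r hr x => ?_⟩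
  have h1 : ∫ z, ‖gibbsWeight φ ε r x z • z‖ ≤ Real.exp (-φ x / ε) * I₁ := by
    rw [hI₁, ← integral_const_mul]
    exact integral_mono (integrable_gibbsWeight_smul hφ hε hr.1 x).norm (hint₁.const_mul _)
      (norm_gibbsWeight_smul_le hφ hε hr x)
  have h2 : Real.exp (-φ x / ε) * I₀ ≤ ∫ z, gibbsWeight φ ε r x z := by
    rw [hI₀, ← integral_const_mul]
    exact integral_mono (hint₀.const_mul _) (integrable_gibbsWeight hφ hε hr.1 x)
      (le_gibbsWeight hφ hε hr x)
  calc _ ≤ Real.exp (-φ x / ε) * I₁ := h1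
    _ = I₁ / I₀ * (Real.exp (-φ x / ε) * I₀) := by field_simp
    _ ≤ _ := by gcongr

theorem norm_gibbsMean_le (hφ : LipschitzWith L φ) (hε : 0 < ε) {r B : ℝ} (hr : 0 ≤ r) {x : 𝔼}
    (hB : ∫ z, ‖gibbsWeight φ ε r x z • z‖ ≤ B * ∫ z, gibbsWeight φ ε r x z) :
    ‖gibbsMean φ ε r x‖ ≤ B := by
  have hpos := integral_gibbsWeight_pos hφ hε hr x
  rw [gibbsMean, norm_smul, Real.norm_of_nonneg (inv_nonneg.mpr hpos.le), inv_mul_le_iff₀ hpos,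
    mul_comm]
  exact (norm_integral_le_integral_norm _).trans hB

theorem gibbsWeight_le_exp_mul (hφ : LipschitzWith L φ) (hε : 0 < ε) (r : ℝ) (x x' z : 𝔼) :
    gibbsWeight φ ε r x' z ≤ Real.exp (L / ε * ‖x - x'‖) * gibbsWeight φ ε r x z := by
  rw [gibbsWeight, gibbsWeight, ← Real.exp_add, Real.exp_le_exp]
  have h1 := neg_div_le_of_lipschitz hφ hε (x + (√ε * r) • z) (x' + (√ε * r) • z)
  rw [add_sub_add_right_eq_sub, neg_div, neg_div] at h1
  linarith

theorem abs_sub_le_of_le_mul {a b c : ℝ} (ha : 0 < a) (hc : 1 ≤ c) (hba : b ≤ c * a)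
    (hab : a ≤ c * b) : |b - a| ≤ (c - 1) * a := by
  rw [abs_le]
  refine ⟨?_, by linarith⟩
  rcases le_total a b with h | h
  · have : 0 ≤ (c - 1) * a := mul_nonneg (by linarith) ha.le
    linarith
  · have : (c - 1) * b ≤ (c - 1) * a := mul_le_mul_of_nonneg_left h (by linarith)
    linarith

theorem inv_mul_le_of_le_mul {D D' w w' c : ℝ} (hD : 0 < D) (hD' : 0 < D') (hw : 0 ≤ w)
    (hww : w' ≤ c * w) (hDD : D ≤ c * D') : D'⁻¹ * w' ≤ c * c * (D⁻¹ * w) := by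
  have hc : 0 < c := pos_of_mul_pos_left (hD.trans_le hDD) hD'.le
  rw [inv_mul_le_iff₀ hD']
  calc w' ≤ c * w := hww
    _ = c * w * (D⁻¹ * D) := by rw [inv_mul_cancel₀ hD.ne', mul_one]
    _ ≤ c * w * (D⁻¹ * (c * D')) := by gcongr
    _ = _ := by ring

/-- Gibbs weights with nearby centres have densities close to one with respect to each other. -/
theorem norm_gibbsMean_sub_le (hφ : LipschitzWith L φ) (hε : 0 < ε) {r B : ℝ} (hr : 0 ≤ r)
    {x x' : 𝔼}
    (hB : ∫ z, ‖gibbsWeight φ ε r x z • z‖ ≤ B * ∫ z, gibbsWeight φ ε r x z) :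
    ‖gibbsMean φ ε r x' - gibbsMean φ ε r x‖ ≤
      B * (Real.exp (2 * (L / ε * ‖x - x'‖)) - 1) := by
  set θ := L / ε * ‖x - x'‖ with hθ
  have hθ0 : 0 ≤ θ := by positivity
  set D := ∫ z, gibbsWeight φ ε r x z with hD
  set D' := ∫ z, gibbsWeight φ ε r x' z with hD'
  have hDpos : 0 < D := integral_gibbsWeight_pos hφ hε hr x
  have hDpos' : 0 < D' := integral_gibbsWeight_pos hφ hε hr x'
  have hw : ∀ z, gibbsWeight φ ε r x' z ≤ Real.exp θ * gibbsWeight φ ε r x z :=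
    gibbsWeight_le_exp_mul hφ hε r x x'
  have hw' : ∀ z, gibbsWeight φ ε r x z ≤ Real.exp θ * gibbsWeight φ ε r x' z := by
    intro z
    rw [hθ, norm_sub_rev]
    exact gibbsWeight_le_exp_mul hφ hε r x' x z
  have hDD : D' ≤ Real.exp θ * D := by
    rw [hD, ← integral_const_mul]
    exact integral_mono (integrable_gibbsWeight hφ hε hr x')
      ((integrable_gibbsWeight hφ hε hr x).const_mul _) hw
  have hDD' : D ≤ Real.exp θ * D' := by
    rw [hD', ← integral_const_mul]
    exact integral_mono (integrable_gibbsWeight hφ hε hr x)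
      ((integrable_gibbsWeight hφ hε hr x').const_mul _) hw'
  have hE : 1 ≤ Real.exp θ := Real.one_le_exp hθ0
  have hE2 : Real.exp (2 * θ) = Real.exp θ * Real.exp θ := by rw [two_mul, Real.exp_add]
  -- The exponent `2 * θ` collects one `θ` from the weight and one from its normalisation.
  have hdens : ∀ z, |D'⁻¹ * gibbsWeight φ ε r x' z - D⁻¹ * gibbsWeight φ ε r x z| ≤
      (Real.exp (2 * θ) - 1) * (D⁻¹ * gibbsWeight φ ε r x z) := by
    intro z
    rw [hE2]
    exact abs_sub_le_of_le_mul (mul_pos (inv_pos.mpr hDpos) (gibbsWeight_pos r x z))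
      (one_le_mul_of_one_le_of_one_le hE hE)
      (inv_mul_le_of_le_mul hDpos hDpos' (gibbsWeight_pos r x z).le (hw z) hDD')
      (inv_mul_le_of_le_mul hDpos' hDpos (gibbsWeight_pos r x' z).le (hw' z) hDD)
  have hint := (integrable_gibbsWeight_smul hφ hε hr x).norm
  have heq : gibbsMean φ ε r x' - gibbsMean φ ε r x = ∫ z,
      (D'⁻¹ * gibbsWeight φ ε r x' z - D⁻¹ * gibbsWeight φ ε r x z) • z := by
    simp only [gibbsMean, sub_smul, mul_smul]
    have i₁ : Integrable (fun z => D'⁻¹ • gibbsWeight φ ε r x' z • z) :=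
      (integrable_gibbsWeight_smul hφ hε hr x').smul D'⁻¹
    have i₂ : Integrable (fun z => D⁻¹ • gibbsWeight φ ε r x z • z) :=
      (integrable_gibbsWeight_smul hφ hε hr x).smul D⁻¹
    rw [integral_sub i₁ i₂, integral_smul, integral_smul]
  rw [heq]
  calc _ ≤ ∫ z, (Real.exp (2 * θ) - 1) * D⁻¹ * ‖gibbsWeight φ ε r x z • z‖ := by
        refine norm_integral_le_of_norm_le (hint.const_mul _) (Eventually.of_forall fun z => ?_)
        rw [norm_smul, norm_smul, Real.norm_eq_abs, Real.norm_of_nonneg (gibbsWeight_pos r x z).le]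
        have := mul_le_mul_of_nonneg_right (hdens z) (norm_nonneg z)
        linarith
    _ = (Real.exp (2 * θ) - 1) * D⁻¹ * ∫ z, ‖gibbsWeight φ ε r x z • z‖ := integral_const_mul _ _
    _ ≤ (Real.exp (2 * θ) - 1) * D⁻¹ * (B * D) := by
        have : 1 ≤ Real.exp (2 * θ) := Real.one_le_exp (by positivity)
        gcongr
    _ = _ := by field_simp

theorem continuousOn_gibbsMean (hφ : LipschitzWith L φ) (hε : 0 < ε) (ρ : ℝ) (x : 𝔼) :
    ContinuousOn (fun r => gibbsMean φ ε r x) (Icc 0 ρ) := by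
  have hcont := hφ.continuous
  have hD : ContinuousOn (fun r => ∫ z, gibbsWeight φ ε r x z) (Icc 0 ρ) := by
    refine continuousOn_of_dominated (bound := fun z => Real.exp (-φ x / ε) *
      Real.exp (-(1 / 2) * ‖z‖ ^ 2 + L / ε * (√ε * ρ) * ‖z‖))
      (fun r _ => (continuous_gibbsWeight hcont r x).aestronglyMeasurable)
      (fun r hr => Eventually.of_forall fun z => ?_)
      ((integrable_exp_neg_norm_sq_add (by norm_num) _).const_mul _)
      (Eventually.of_forall fun z => (continuous_gibbsWeight_time hcont x z).continuousOn)
    rw [Real.norm_of_nonneg (gibbsWeight_pos r x z).le]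
    exact gibbsWeight_le hφ hε hr x z
  have hN : ContinuousOn (fun r => ∫ z, gibbsWeight φ ε r x z • z) (Icc 0 ρ) :=
    continuousOn_of_dominated (bound := fun z => Real.exp (-φ x / ε) *
      (‖z‖ * Real.exp (-(1 / 2) * ‖z‖ ^ 2 + L / ε * (√ε * ρ) * ‖z‖)))
      (fun r _ => ((continuous_gibbsWeight hcont r x).smul continuous_id).aestronglyMeasurable)
      (fun r hr => Eventually.of_forall fun z => norm_gibbsWeight_smul_le hφ hε hr x z)
      ((integrable_norm_mul_exp (by norm_num) _).const_mul _)
      (Eventually.of_forall fun z =>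
        ((continuous_gibbsWeight_time hcont x z).smul continuous_const).continuousOn)
  exact (hD.inv₀ fun r hr => (integral_gibbsWeight_pos hφ hε hr.1 x).ne').smul hN

/-- The substitution `y = x + √(ε t) • z` in numerator and denominator; it isolates the singular
factor `t ^ (-1/2)`. -/
theorem gradient_viscousPotential (hφ : LipschitzWith L φ) (hε : 0 < ε) {t : ℝ} (ht : 0 < t)
    (x : 𝔼) :
    gradient (viscousPotential φ ε t) x = -(√ε / √t) • gibbsMean φ ε √t x := by
  rw [(hasGradientAt_viscousPotential hφ hε ht x).gradient]
  set κ := √ε * √t with hκ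
  have hsε := Real.sqrt_pos.mpr hε
  have hst := Real.sqrt_pos.mpr ht
  have hκpos : 0 < κ := by positivity
  have hκ2 : κ ^ 2 = ε * t := by rw [hκ, mul_pow, Real.sq_sqrt hε.le, Real.sq_sqrt ht.le]
  have hker : ∀ z : 𝔼, Real.exp (-‖x - (x + κ • z)‖ ^ 2 / (2 * ε * t) - φ (x + κ • z) / ε) =
      gibbsWeight φ ε √t x z := by
    intro z
    rw [gibbsWeight, sub_add_cancel_left, norm_neg, norm_smul, mul_pow, Real.norm_eq_abs, sq_abs,
      hκ2]
    congr 2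
    field_simp
  have hH : heatIntegral φ ε t x = κ ^ d * ∫ z, gibbsWeight φ ε √t x z := by
    simp only [← hker]
    rw [Measure.integral_comp_smul volume
      (fun y : 𝔼 => Real.exp (-‖x - (x + y)‖ ^ 2 / (2 * ε * t) - φ (x + y) / ε)),
      integral_add_left_eq_self
      (fun y : 𝔼 => Real.exp (-‖x - y‖ ^ 2 / (2 * ε * t) - φ y / ε)) x, heatIntegral,
      finrank_euclideanSpace_fin, abs_of_pos (by positivity), smul_eq_mul]
    field_simp
  have hG : ∫ y, (t⁻¹ * Real.exp (-‖x - y‖ ^ 2 / (2 * ε * t) - φ y / ε)) • (x - y) =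
      (κ ^ d * (-(t⁻¹ * κ))) • ∫ z, gibbsWeight φ ε √t x z • z := by
    have h1 : ∀ z : 𝔼, (-(t⁻¹ * κ)) • gibbsWeight φ ε √t x z • z =
        (t⁻¹ * Real.exp (-‖x - (x + κ • z)‖ ^ 2 / (2 * ε * t) - φ (x + κ • z) / ε)) •
          (x - (x + κ • z)) := by
      intro z
      rw [hker, sub_add_cancel_left]
      module
    rw [mul_smul, ← integral_smul (-(t⁻¹ * κ))]
    simp only [h1]
    rw [Measure.integral_comp_smul volume
      (fun y : 𝔼 => (t⁻¹ * Real.exp (-‖x - (x + y)‖ ^ 2 / (2 * ε * t) - φ (x + y) / ε)) •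
          (x - (x + y))),
      integral_add_left_eq_self
      (fun y : 𝔼 => (t⁻¹ * Real.exp (-‖x - y‖ ^ 2 / (2 * ε * t) - φ y / ε)) • (x - y)) x,
      finrank_euclideanSpace_fin, abs_of_pos (by positivity), smul_smul,
      mul_inv_cancel₀ (by positivity), one_smul]
  rw [hG, hH, gibbsMean, smul_smul, smul_smul]
  congr 1
  have hD := (integral_gibbsWeight_pos hφ hε (Real.sqrt_nonneg t) x).ne'
  have hκt : t⁻¹ * κ = √ε / √t := by
    rw [hκ]
    field_simp
    rw [Real.sq_sqrt ht.le]
  rw [hκt]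
  field_simp

end Velocity

/-! ### Existence and uniqueness of viscous paths. -/

section Paths

variable {d : ℕ} {φ : EuclideanSpace ℝ (Fin d) → ℝ} {L : NNReal} {ε : ℝ}

local notation "𝔼" => EuclideanSpace ℝ (Fin d)

/-- The viscous velocity is singular like `t ^ (-1/2)`, which the substitution `t = r ^ 2`
removes. -/
theorem exists_viscousPath_Icc (hφ : LipschitzWith L φ) (hε : 0 < ε) {ρ : ℝ} (hρ : 0 < ρ) (y : 𝔼) :
    ∃ z : ℝ → 𝔼, z 0 = y ∧ ContinuousOn z (Icc 0 (ρ ^ 2)) ∧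
      ∀ t ∈ Ioo 0 (ρ ^ 2), HasDerivAt z (gradient (viscousPotential φ ε t) (z t)) t := by
  obtain ⟨B, hB0, hB⟩ := exists_gibbs_moment_le hφ hε ρ
  set V : ℝ → 𝔼 → 𝔼 := fun r x => -(2 * √ε) • gibbsMean φ ε r x with hV
  have hsε := Real.sqrt_pos.mpr hε
  set M : ℝ := 2 * √ε * B with hM
  have hM0 : 0 ≤ M := by positivity
  -- At speed at most `M` the solution stays in the ball of radius `M * ρ` throughout `[0, ρ]`, so a
  -- single Picard–Lindelöf step suffices.
  set a : ℝ := M * ρ with ha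
  have ha0 : 0 ≤ a := by positivity
  set l : ℝ := 2 * (L / ε) with hl
  have hl0 : 0 ≤ l := by positivity
  have hVn : ∀ c : ℝ, ∀ u : 𝔼, ‖(-(2 * c)) • u‖ = |2 * c| * ‖u‖ := fun c u => by
    rw [norm_smul, Real.norm_eq_abs, abs_neg]
  have hpl : IsPicardLindelof V (⟨0, ⟨le_rfl, hρ.le⟩⟩ : Icc 0 ρ) y ⟨a, ha0⟩ 0 ⟨M, hM0⟩
      ⟨M * (l * Real.exp (l * (2 * a))), by positivity⟩ := by
    refine ⟨fun r hr => ?_, fun x _ => ?_, fun r hr x _ => ?_, ?_⟩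
    · refine LipschitzOnWith.of_dist_le_mul fun x hx x' hx' => ?_
      have hxx : ‖x' - x‖ ≤ 2 * a := by
        have h1 : dist x y ≤ a := hx
        have h2 : dist x' y ≤ a := hx'
        rw [← dist_eq_norm]
        linarith [dist_triangle_right x' x y]
      have h1 := norm_gibbsMean_sub_le hφ hε hr.1 (x' := x) (hB r hr x')
      have h2 : Real.exp (2 * (L / ε * ‖x' - x‖)) - 1 ≤
          l * ‖x' - x‖ * Real.exp (l * (2 * a)) := by
        have h3 : 2 * (L / ε * ‖x' - x‖) = l * ‖x' - x‖ := by rw [hl]; ring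
        rw [h3]
        set s := l * ‖x' - x‖ with hs
        have hs0 : 0 ≤ s := by positivity
        have h4 : Real.exp s - 1 ≤ s * Real.exp s := by
          have h5 := Real.add_one_le_exp (-s)
          have h6 : Real.exp (-s) * Real.exp s = 1 := by rw [← Real.exp_add]; simp
          nlinarith [Real.exp_pos s]
        have h5 : s ≤ l * (2 * a) := mul_le_mul_of_nonneg_left hxx hl0
        exact h4.trans (by gcongr)
      rw [dist_eq_norm, dist_eq_norm, hV]
      simp only
      rw [← smul_sub, hVn, abs_of_pos (by positivity), norm_sub_rev x x']
      calc 2 * √ε * ‖gibbsMean φ ε r x - gibbsMean φ ε r x'‖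
          ≤ 2 * √ε * (B * (l * ‖x' - x‖ * Real.exp (l * (2 * a)))) := by
            gcongr
            exact h1.trans (by gcongr)
        _ = M * (l * Real.exp (l * (2 * a))) * ‖x' - x‖ := by rw [hM]; ring
    · exact (continuousOn_gibbsMean hφ hε ρ x).const_smul (-(2 * √ε))
    · rw [hV]
      simp only
      rw [hVn, abs_of_pos (by positivity)]
      change 2 * √ε * ‖gibbsMean φ ε r x‖ ≤ 2 * √ε * B
      gcongr
      exact norm_gibbsMean_le hφ hε hr.1 (hB r hr x)
    · change M * max (ρ - 0) (0 - 0) ≤ a - 0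
      rw [sub_zero, sub_zero, sub_zero, max_eq_left hρ.le]
  obtain ⟨α, hα0, hα⟩ := hpl.exists_eq_forall_mem_Icc_hasDerivWithinAt₀
  refine ⟨fun t => α √t, by simpa using hα0, ?_, fun t ht => ?_⟩
  · have hαc : ContinuousOn α (Icc 0 ρ) := fun r hr => (hα r hr).continuousWithinAt
    refine hαc.comp Real.continuous_sqrt.continuousOn fun t ht => ⟨Real.sqrt_nonneg t, ?_⟩
    exact (Real.sqrt_le_left hρ.le).mpr ht.2
  · have hst := Real.sqrt_pos.mpr ht.1
    have hlt : √t < ρ := (Real.sqrt_lt' hρ).mpr ht.2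
    have h1 := (hα √t ⟨hst.le, hlt.le⟩).hasDerivAt (Icc_mem_nhds hst hlt)
    have h2 := h1.scomp t (Real.hasDerivAt_sqrt ht.1.ne')
    rw [gradient_viscousPotential hφ hε ht.1]
    have h3 : (1 / (2 * √t)) • V √t (α √t) = -(√ε / √t) • gibbsMean φ ε √t (α √t) := by
      rw [hV, smul_smul]
      congr 1
      field_simp
    rw [h3] at h2
    exact h2

theorem inner_gradient_viscousPotential_sub_le (hφ : LipschitzWith L φ)
    (hconc : ConcaveOn ℝ univ φ) (hε : 0 < ε) {t : ℝ} (ht : 0 < t) (x₁ x₂ : 𝔼) :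
    inner ℝ (gradient (viscousPotential φ ε t) x₁ - gradient (viscousPotential φ ε t) x₂)
      (x₁ - x₂) ≤ 0 := by
  have h := inner_sub_sub_le_of_supergradients (f := viscousPotential φ ε t) (δ₁ := 0) (δ₂ := 0)
    ((viscousPotential_le_add_inner hφ hconc hε ht x₁ x₂).trans_eq (add_zero _).symm)
    ((viscousPotential_le_add_inner hφ hconc hε ht x₂ x₁).trans_eq (add_zero _).symm)
  rwa [add_zero] at h

theorem viscousPath_eqOn_Icc (hφ : LipschitzWith L φ) (hconc : ConcaveOn ℝ univ φ) (hε : 0 < ε)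
    {T : ℝ} {z₁ z₂ : ℝ → 𝔼} (h0 : z₁ 0 = z₂ 0)
    (hc₁ : ContinuousOn z₁ (Icc 0 T)) (hc₂ : ContinuousOn z₂ (Icc 0 T))
    (h₁ : ∀ t ∈ Ioo 0 T, HasDerivAt z₁ (gradient (viscousPotential φ ε t) (z₁ t)) t)
    (h₂ : ∀ t ∈ Ioo 0 T, HasDerivAt z₂ (gradient (viscousPotential φ ε t) (z₂ t)) t) :
    EqOn z₁ z₂ (Icc 0 T) := by
  intro t ht
  have h := norm_sub_sq_le_of_inner_deriv_le hc₁ hc₂ (δ := 0) (fun s hs =>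
    ⟨_, _, h₁ s hs, h₂ s hs, inner_gradient_viscousPotential_sub_le hφ hconc hε hs.1 _ _⟩) ht
  rw [h0, sub_self, norm_zero] at h
  have h' : ‖z₁ t - z₂ t‖ = 0 := by nlinarith [norm_nonneg (z₁ t - z₂ t)]
  exact sub_eq_zero.mp (norm_eq_zero.mp h')

theorem IsViscousPath.eqOn (hφ : LipschitzWith L φ) (hconc : ConcaveOn ℝ univ φ) (hε : 0 < ε)
    {y : 𝔼} {z₁ z₂ : ℝ → 𝔼} (h₁ : IsViscousPath φ ε y z₁) (h₂ : IsViscousPath φ ε y z₂) :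
    EqOn z₁ z₂ (Ici 0) := fun t ht =>
  viscousPath_eqOn_Icc hφ hconc hε (h₁.1.trans h₂.1.symm) (h₁.2.1.mono Icc_subset_Ici_self)
    (h₂.2.1.mono Icc_subset_Ici_self) (fun s hs => h₁.2.2 s hs.1) (fun s hs => h₂.2.2 s hs.1)
    ⟨ht, le_refl t⟩

theorem exists_isViscousPath (hφ : LipschitzWith L φ) (hconc : ConcaveOn ℝ univ φ) (hε : 0 < ε)
    (y : 𝔼) : ∃ z, IsViscousPath φ ε y z := by
  have hex : ∀ n : ℕ, ∃ z : ℝ → 𝔼, z 0 = y ∧ ContinuousOn z (Icc 0 (n + 1)) ∧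
      ∀ t ∈ Ioo (0 : ℝ) (n + 1), HasDerivAt z (gradient (viscousPotential φ ε t) (z t)) t := by
    intro n
    have hn : (0 : ℝ) < n + 1 := by positivity
    have h := exists_viscousPath_Icc hφ hε (Real.sqrt_pos.mpr hn) y
    rwa [Real.sq_sqrt hn.le] at h
  choose z hz0 hzc hzd using hex
  have hagree : ∀ {m n : ℕ}, m ≤ n → EqOn (z m) (z n) (Icc 0 (m + 1)) := by
    intro m n hmn
    have hle : (m : ℝ) + 1 ≤ n + 1 := by
      have : (m : ℝ) ≤ n := by exact_mod_cast hmn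
      linarith
    exact viscousPath_eqOn_Icc hφ hconc hε ((hz0 m).trans (hz0 n).symm) (hzc m)
      ((hzc n).mono (Icc_subset_Icc_right hle)) (hzd m)
      (fun t ht => hzd n t ⟨ht.1, ht.2.trans_le hle⟩)
  -- Solutions on `[0, n + 1]` agree where they overlap, by uniqueness, and are glued.
  set w : ℝ → 𝔼 := fun t => z ⌈t⌉₊ t with hw
  have hwz : ∀ n : ℕ, EqOn w (z n) (Icc 0 n) := by
    intro n t ht
    exact hagree (Nat.ceil_le.mpr ht.2) ⟨ht.1, (Nat.le_ceil t).trans (by linarith)⟩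
  refine ⟨w, ?_, ?_, ?_⟩
  · rw [hwz 0 (by simp)]
    exact hz0 0
  · intro t ht
    have ht' : (0 : ℝ) ≤ t := ht
    set n := ⌈t⌉₊ + 1 with hn
    have htn : t < n := by
      rw [hn]
      push_cast
      linarith [Nat.le_ceil t]
    have h1 : ContinuousWithinAt w (Icc 0 n) t :=
      (((hzc n).mono (Icc_subset_Icc_right (by linarith))).congr (hwz n)) t ⟨ht', htn.le⟩
    refine h1.mono_of_mem_nhdsWithin ?_
    rw [← Ici_inter_Iic]
    exact inter_mem self_mem_nhdsWithin (mem_nhdsWithin_of_mem_nhds (Iic_mem_nhds htn))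
  · intro t ht
    set n := ⌈t⌉₊ + 1 with hn
    have htn : t < n := by
      rw [hn]
      push_cast
      linarith [Nat.le_ceil t]
    have h1 := hzd n t ⟨ht, by linarith⟩
    rw [← hwz n ⟨ht.le, htn.le⟩] at h1
    exact h1.congr_of_eventuallyEq ((hwz n).eventuallyEq_of_mem (Icc_mem_nhds ht htn))

theorem isViscousPath_viscousFlow (hφ : LipschitzWith L φ) (hconc : ConcaveOn ℝ univ φ)
    (hε : 0 < ε) (y : 𝔼) : IsViscousPath φ ε y (fun t => viscousFlow φ ε t y) :=
  Classical.epsilon_spec (exists_isViscousPath hφ hconc hε y)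

end Paths

/-! ### Cole–Hopf bounds for three-sector data. -/

section ThreeSectorFlow

variable {v : Fin 3 → EuclideanSpace ℝ (Fin 2)}

theorem exists_lipschitzWith_threeSector (v : Fin 3 → EuclideanSpace ℝ (Fin 2)) :
    ∃ L, LipschitzWith L (threeSector v) := by
  refine ⟨∑ i, ‖v i‖₊, LipschitzWith.of_le_add_mul _ fun x y => ?_⟩
  obtain ⟨i, hi⟩ := exists_threeSector_eq v y
  have h1 := threeSector_le (b := v) x i
  have h2 : inner ℝ (v i) x = inner ℝ (v i) y + inner ℝ (v i) (x - y) := by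
    rw [inner_sub_right]
    ring
  have h3 := real_inner_le_norm (v i) (x - y)
  have h4 : ‖v i‖ ≤ ∑ i, ‖v i‖ :=
    Finset.single_le_sum (f := fun i => ‖v i‖) (fun i _ => norm_nonneg _) (Finset.mem_univ i)
  push_cast
  rw [dist_eq_norm]
  have h5 := mul_le_mul_of_nonneg_right h4 (norm_nonneg (x - y))
  linarith

theorem concaveOn_threeSector (v : Fin 3 → EuclideanSpace ℝ (Fin 2)) :
    ConcaveOn ℝ univ (threeSector v) := by
  refine ⟨convex_univ, fun x _ y _ a c ha hc _ => le_threeSector fun i => ?_⟩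
  rw [inner_add_right, real_inner_smul_right, real_inner_smul_right, smul_eq_mul, smul_eq_mul]
  exact add_le_add (mul_le_mul_of_nonneg_left (threeSector_le x i) ha)
    (mul_le_mul_of_nonneg_left (threeSector_le y i) hc)

/-- The Cole-Hopf potential differs from the inviscid one by at most `ε log 3`. -/
theorem viscousPotential_threeSector_bounds {ε t : ℝ} (hε : 0 < ε) (ht : 0 < t)
    (x : EuclideanSpace ℝ (Fin 2)) :
    (∀ i, viscousPotential (threeSector v) ε t x ≤ inner ℝ (v i) x - t * ‖v i‖ ^ 2 / 2) ∧
      ∀ a, (∀ i, a ≤ inner ℝ (v i) x - t * ‖v i‖ ^ 2 / 2) →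
        a - ε * Real.log 3 ≤ viscousPotential (threeSector v) ε t x := by
  obtain ⟨L, hL⟩ := exists_lipschitzWith_threeSector v
  have hint := integrable_heatKernel hL hε ht x
  have hinti : ∀ i, Integrable
      (fun y => Real.exp (-‖x - y‖ ^ 2 / (2 * ε * t) - inner ℝ (v i) y / ε)) := by
    intro i
    have hLi : LipschitzWith ‖v i‖₊ (fun y => (inner ℝ (v i) y : ℝ)) := by
      refine LipschitzWith.of_dist_le_mul fun y y' => ?_
      rw [Real.dist_eq, ← inner_sub_right, dist_eq_norm]
      exact abs_real_inner_le_norm _ _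
    exact integrable_heatKernel hLi hε ht x
  set c : ℝ := (2 * Real.pi * ε * t) ^ (((2 : ℕ) : ℝ) / 2) with hc
  have hcpos : 0 < c := Real.rpow_pos_of_pos (by positivity) _
  have hval : ∀ i, ∫ y, Real.exp (-‖x - y‖ ^ 2 / (2 * ε * t) - inner ℝ (v i) y / ε) =
      c * Real.exp (-(inner ℝ (v i) x - t * ‖v i‖ ^ 2 / 2) / ε) := by
    intro i
    have h1 : 2 * ε * t = 2 * (ε * t) := by ring
    have h2 : 2 * Real.pi * ε * t = 2 * Real.pi * (ε * t) := by ring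
    rw [hc, h1, h2, integral_exp_neg_norm_sub_sq_sub_inner (by positivity)]
    congr 2
    field_simp
    ring
  set I := heatIntegral (threeSector v) ε t x with hI
  have hIpos : 0 < I := heatIntegral_pos hL hε ht x
  have hu : viscousPotential (threeSector v) ε t x = -ε * Real.log (I / c) := by
    have : viscousPotential (threeSector v) ε t x = -ε * Real.log (1 / c * I) := rfl
    rw [this]
    congr 2
    ring
  constructor
  · intro i
    have h1 : c * Real.exp (-(inner ℝ (v i) x - t * ‖v i‖ ^ 2 / 2) / ε) ≤ I := by
      rw [← hval i]
      refine integral_mono (hinti i) hint fun y => Real.exp_le_exp.mpr ?_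
      have := div_le_div_of_nonneg_right (threeSector_le (b := v) y i) hε.le
      linarith
    have h2 : -(inner ℝ (v i) x - t * ‖v i‖ ^ 2 / 2) / ε ≤ Real.log (I / c) := by
      rw [Real.le_log_iff_exp_le (by positivity), le_div_iff₀ hcpos]
      linarith
    rw [div_le_iff₀ hε] at h2
    rw [hu]
    linarith
  · intro a ha
    -- The kernel for the minimum is the largest of the three linear kernels, hence at most their
    -- sum; the three terms produce `log 3`.
    have h1 : I ≤ ∑ i, c * Real.exp (-(inner ℝ (v i) x - t * ‖v i‖ ^ 2 / 2) / ε) := by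
      simp only [← hval]
      rw [← integral_finsetSum _ fun i _ => hinti i]
      refine integral_mono hint (integrable_finsetSum _ fun i _ => hinti i) fun y => ?_
      obtain ⟨i, hi⟩ := exists_threeSector_eq v y
      simp only
      rw [← hi]
      exact Finset.single_le_sum
        (f := fun i => Real.exp (-‖x - y‖ ^ 2 / (2 * ε * t) - inner ℝ (v i) y / ε))
        (fun i _ => (Real.exp_pos _).le) (Finset.mem_univ i)
    have h2 : ∑ i, c * Real.exp (-(inner ℝ (v i) x - t * ‖v i‖ ^ 2 / 2) / ε) ≤
        ∑ _i : Fin 3, c * Real.exp (-a / ε) := by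
      refine Finset.sum_le_sum fun i _ => ?_
      have := ha i
      gcongr
    simp only [Finset.sum_const, Finset.card_univ, Fintype.card_fin, nsmul_eq_mul] at h2
    have h3 : Real.log (I / c) ≤ Real.log 3 + -a / ε := by
      rw [Real.log_le_iff_le_exp (by positivity), Real.exp_add, Real.exp_log (by norm_num),
        div_le_iff₀ hcpos]
      push_cast at h2
      linarith
    have h4 := mul_le_mul_of_nonneg_left h3 hε.le
    rw [mul_add, mul_div_cancel₀ _ hε.ne'] at h4
    rw [hu]
    linarith

end ThreeSectorFlow

/-! ### The zero-viscosity limit as a gradient flow. -/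

section LagrangianFlow

variable {v : Fin 3 → EuclideanSpace ℝ (Fin 2)} {q : EuclideanSpace ℝ (Fin 2)} {R : ℝ}

/-- In the frame moving with the circumcenter the inviscid potential is stationary up to an
additive constant. -/
theorem inner_moving_frame (hR : ∀ i, ‖v i - q‖ = R) (t : ℝ) (x : EuclideanSpace ℝ (Fin 2))
    (i : Fin 3) : inner ℝ (v i) (x + t • q) - t * ‖v i‖ ^ 2 / 2 =
      inner ℝ (v i - q) x + inner ℝ q x + t * (‖q‖ ^ 2 - R ^ 2) / 2 := by
  have h := norm_sub_sq_real (v i) q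
  rw [hR] at h
  rw [inner_add_right, real_inner_smul_right, inner_sub_left, h]
  ring

/-- Concavity gives an exact supergradient of the viscous potential; passing to the inviscid one
costs nothing at `z t` (upper bound) and `ε log 3` at the test point (lower bound). -/
theorem IsViscousPath.isApproxGradientPath (hR : ∀ i, ‖v i - q‖ = R) {ε : ℝ} (hε : 0 < ε)
    {y : EuclideanSpace ℝ (Fin 2)} {z : ℝ → EuclideanSpace ℝ (Fin 2)}
    (hz : IsViscousPath (threeSector v) ε y z) (T : ℝ) :
    IsApproxGradientPath (threeSector fun i => v i - q) (ε * Real.log 3) T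
      (fun t => z t - t • q) := by
  obtain ⟨L, hL⟩ := exists_lipschitzWith_threeSector v
  refine ⟨(hz.2.1.mono Icc_subset_Ici_self).sub (by fun_prop), fun t ht => ?_⟩
  have hder : HasDerivAt (fun t : ℝ => t • q) q t := by
    simpa using (hasDerivAt_id t).smul_const q
  refine ⟨_, (hz.2.2 t ht.1).sub hder, fun w => ?_⟩
  set x := z t - t • q with hx
  have hzx : z t = x + t • q := by rw [hx]; abel
  have hconc := viscousPotential_le_add_inner hL (concaveOn_threeSector v) hε ht.1 (z t)
    (w + t • q)
  have hlow := (viscousPotential_threeSector_bounds (v := v) hε ht.1 (w + t • q)).2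
    (threeSector (fun i => v i - q) w + inner ℝ q w + t * (‖q‖ ^ 2 - R ^ 2) / 2) (fun i => by
      rw [inner_moving_frame hR]
      linarith [threeSector_le (b := fun i => v i - q) w i])
  obtain ⟨i, hi⟩ := exists_threeSector_eq (fun i => v i - q) x
  have hup := (viscousPotential_threeSector_bounds (v := v) hε ht.1 (z t)).1 i
  have hframe := inner_moving_frame hR t x i
  rw [← hzx] at hframe
  rw [hframe, hi] at hup
  have hdiff : w + t • q - z t = w - x := by rw [hzx]; abel
  rw [hdiff] at hconc
  rw [inner_sub_left, inner_sub_right q]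
  linarith

theorem norm_viscousFlow_sub_sq_le (hR : ∀ i, ‖v i - q‖ = R) {ε ε' t : ℝ} (hε : 0 < ε)
    (hε' : 0 < ε') (ht : 0 ≤ t) (y : EuclideanSpace ℝ (Fin 2)) :
    ‖viscousFlow (threeSector v) ε t y - viscousFlow (threeSector v) ε' t y‖ ^ 2 ≤
      2 * (ε * Real.log 3 + ε' * Real.log 3) * t := by
  obtain ⟨L, hL⟩ := exists_lipschitzWith_threeSector v
  have h₁ := isViscousPath_viscousFlow hL (concaveOn_threeSector v) hε y
  have h₂ := isViscousPath_viscousFlow hL (concaveOn_threeSector v) hε' y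
  have h := (h₁.isApproxGradientPath hR hε t).norm_sub_sq_le (h₂.isApproxGradientPath hR hε' t)
    (t := t) ⟨ht, le_rfl⟩
  have h0 : viscousFlow (threeSector v) ε 0 y = viscousFlow (threeSector v) ε' 0 y :=
    h₁.1.trans h₂.1.symm
  rw [sub_sub_sub_cancel_right, h0, sub_self, norm_zero] at h
  linarith

theorem tendsto_viscousFlow (hR : ∀ i, ‖v i - q‖ = R) {t : ℝ} (ht : 0 ≤ t)
    (y : EuclideanSpace ℝ (Fin 2)) :
    Tendsto (fun ε => viscousFlow (threeSector v) ε t y) (𝓝[>] 0)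
      (𝓝 (lagrangianFlow (threeSector v) t y)) := by
  refine tendsto_nhds_limUnder (cauchy_map_iff_exists_tendsto.mp ?_)
  rw [Metric.cauchy_iff]
  refine ⟨inferInstance, fun η hη => ?_⟩
  have hlim : Tendsto (fun a : ℝ => √(2 * (a * Real.log 3 + a * Real.log 3) * t)) (𝓝[>] 0)
      (𝓝 0) := by
    have h : Tendsto (fun a : ℝ => √(2 * (a * Real.log 3 + a * Real.log 3) * t)) (𝓝 0)
        (𝓝 √(2 * (0 * Real.log 3 + 0 * Real.log 3) * t)) := Continuous.tendsto (by fun_prop) 0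
    simpa using h.mono_left nhdsWithin_le_nhds
  obtain ⟨a, ha, ha0⟩ := ((hlim.eventually_lt_const hη).and eventually_mem_nhdsWithin).exists
  refine ⟨_, image_mem_map (Ioo_mem_nhdsGT ha0), ?_⟩
  rintro _ ⟨ε, hε, rfl⟩ _ ⟨ε', hε', rfl⟩
  rw [dist_eq_norm]
  refine lt_of_le_of_lt (Real.le_sqrt_of_sq_le
    ((norm_viscousFlow_sub_sq_le hR hε.1 hε'.1 ht y).trans ?_)) ha
  have hlog : 0 ≤ Real.log 3 := Real.log_nonneg (by norm_num)
  gcongr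
  · exact hε.2.le
  · exact hε'.2.le

theorem isGradientFlow_lagrangianFlow (hR : ∀ i, ‖v i - q‖ = R) :
    IsGradientFlow (threeSector fun i => v i - q)
      (fun t y => lagrangianFlow (threeSector v) t y - t • q) := by
  obtain ⟨L, hL⟩ := exists_lipschitzWith_threeSector v
  intro y T δ hT hδ
  have hlog : 0 < Real.log 3 := Real.log_pos (by norm_num)
  have hε : 0 < δ / Real.log 3 := by positivity
  have hpath := isViscousPath_viscousFlow hL (concaveOn_threeSector v) hε y
  -- Viscosity `δ / log 3` gives error exactly `δ`.
  refine ⟨fun t => viscousFlow (threeSector v) (δ / Real.log 3) t y - t • q, ?_, ?_, ?_⟩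
  · simpa using hpath.1
  · have := hpath.isApproxGradientPath hR hε T
    rwa [div_mul_cancel₀ _ hlog.ne'] at this
  · intro t ht
    rw [sub_sub_sub_cancel_right]
    have h1 := ((tendsto_viscousFlow hR ht.1 y).const_sub
      (viscousFlow (threeSector v) (δ / Real.log 3) t y)).norm.pow 2
    have h2 : Tendsto (fun a : ℝ => 2 * (δ + a * Real.log 3) * t) (𝓝[>] 0)
        (𝓝 (2 * (δ + 0 * Real.log 3) * t)) :=
      (Continuous.tendsto (by fun_prop) 0).mono_left nhdsWithin_le_nhds
    rw [zero_mul, add_zero] at h2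
    refine le_of_tendsto_of_tendsto h1 h2 ?_
    filter_upwards [eventually_mem_nhdsWithin] with a ha
    have := norm_viscousFlow_sub_sq_le hR hε ha ht.1 y
    rwa [div_mul_cancel₀ _ hlog.ne'] at this

theorem continuous_lagrangianFlow (hR : ∀ i, ‖v i - q‖ = R) {t : ℝ} (ht : 0 ≤ t) :
    Continuous (lagrangianFlow (threeSector v) t) := by
  have h := (isGradientFlow_lagrangianFlow hR).continuous ht
  simpa only [sub_add_cancel] using h.fun_add (continuous_const (y := t • q))

end LagrangianFlow

/-! ### The Monge–Ampère measure as a pushforward under the resolvent. -/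

section MongeAmpere

variable {v : Fin 3 → EuclideanSpace ℝ (Fin 2)} {q : EuclideanSpace ℝ (Fin 2)} {R : ℝ}

/-- Completing the square, the supremum is `max_i ‖x - t • v i‖² / 2`, attained at some `y = x - t •
v i`; equidistance from `q` makes the quadratic part independent of `i`. -/
theorem convexPotential_threeSector (hR : ∀ i, ‖v i - q‖ = R) {t : ℝ} (ht : 0 ≤ t)
    (x : EuclideanSpace ℝ (Fin 2)) :
    convexPotential (threeSector v) t x = ‖x - t • q‖ ^ 2 / 2 + t ^ 2 * R ^ 2 / 2 -
      t * threeSector (fun i => v i - q) (x - t • q) := by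
  have hsq : ∀ i, ‖x - t • v i‖ ^ 2 / 2 = ‖x - t • q‖ ^ 2 / 2 + t ^ 2 * R ^ 2 / 2 -
      t * inner ℝ (v i - q) (x - t • q) := by
    intro i
    have h1 : x - t • v i = (x - t • q) - t • (v i - q) := by module
    rw [h1, norm_sub_sq_real (x - t • q), norm_smul, mul_pow, hR, Real.norm_eq_abs, sq_abs,
      real_inner_smul_right, real_inner_comm]
    ring
  have hval : ∀ (i : Fin 3) (y : EuclideanSpace ℝ (Fin 2)),
      inner ℝ x y - ‖y‖ ^ 2 / 2 - t * inner ℝ (v i) y =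
        ‖x - t • v i‖ ^ 2 / 2 - ‖x - t • v i - y‖ ^ 2 / 2 := by
    intro i y
    rw [norm_sub_sq_real (x - t • v i) y, inner_sub_left, real_inner_smul_left]
    ring
  have hle : ∀ y : EuclideanSpace ℝ (Fin 2), inner ℝ x y - ‖y‖ ^ 2 / 2 - t * threeSector v y ≤
      ‖x - t • q‖ ^ 2 / 2 + t ^ 2 * R ^ 2 / 2 -
        t * threeSector (fun i => v i - q) (x - t • q) := by
    intro y
    obtain ⟨i, hi⟩ := exists_threeSector_eq v y
    rw [← hi, hval, hsq]
    have h1 := mul_le_mul_of_nonneg_left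
      (threeSector_le (b := fun i => v i - q) (x - t • q) i) ht
    have h2 := sq_nonneg ‖x - t • v i - y‖
    linarith
  apply le_antisymm (ciSup_le hle)
  obtain ⟨i, hi⟩ := exists_threeSector_eq (fun i => v i - q) (x - t • q)
  refine le_trans ?_ (le_ciSup (f := fun y : EuclideanSpace ℝ (Fin 2) =>
    inner ℝ x y - ‖y‖ ^ 2 / 2 - t * threeSector v y) ⟨_, forall_mem_range.mpr hle⟩ (x - t • v i))
  have h1 := hval i (x - t • v i)
  have h3 := hsq i
  rw [sub_self, norm_zero] at h1
  rw [hi] at h3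
  have h2 := mul_le_mul_of_nonneg_left (threeSector_le (b := v) (x - t • v i) i) ht
  linarith

theorem mem_subgradient_convexPotential_iff (hR : ∀ i, ‖v i - q‖ = R) {t : ℝ} (ht : 0 ≤ t)
    {x y : EuclideanSpace ℝ (Fin 2)} :
    y ∈ subgradient (convexPotential (threeSector v) t) x ↔
      IsResolvent (threeSector fun i => v i - q) t y (x - t • q) := by
  have strong : ∀ {x}, IsResolvent (threeSector fun i => v i - q) t y (x - t • q) → ∀ z,
      convexPotential (threeSector v) t x + inner ℝ y (z - x) + ‖z - x‖ ^ 2 / 2 ≤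
        convexPotential (threeSector v) t z := by
    intro x h z
    have h1 := h (z - t • q)
    have h2 : z - x = (z - t • q) - (x - t • q) := by abel
    rw [convexPotential_threeSector hR ht, convexPotential_threeSector hR ht, h2,
      norm_sub_sq_real (z - t • q), real_inner_comm (x - t • q) (z - t • q)]
    rw [inner_sub_left, inner_sub_right (x - t • q), real_inner_self_eq_norm_sq] at h1
    linarith
  constructor
  · intro h
    obtain ⟨x', hx'⟩ := exists_isResolvent_threeSector (fun i => v i - q) ht y
    have hx'' : IsResolvent (threeSector fun i => v i - q) t y (x' + t • q - t • q) := by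
      rwa [add_sub_cancel_right]
    -- The resolvent satisfies the subgradient inequality with a quadratic gain, so any other point
    -- having `y` as a subgradient must coincide with it.
    have h1 := strong hx'' x
    have h2 := h (x' + t • q)
    have h3 : inner ℝ y (x' + t • q - x) = -inner ℝ y (x - (x' + t • q)) := by
      rw [← inner_neg_right, neg_sub]
    have h4 : ‖x - (x' + t • q)‖ = 0 := by nlinarith [norm_nonneg (x - (x' + t • q))]
    rw [sub_eq_zero.mp (norm_eq_zero.mp h4)]
    exact hx''
  · intro h z
    have := strong h z
    nlinarith [sq_nonneg ‖z - x‖]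

theorem exists_continuous_isResolvent (b : Fin 3 → EuclideanSpace ℝ (Fin 2)) {t : ℝ}
    (ht : 0 ≤ t) : ∃ J : EuclideanSpace ℝ (Fin 2) → EuclideanSpace ℝ (Fin 2), Continuous J ∧
      ∀ y x, IsResolvent (threeSector b) t y x ↔ x = J y := by
  choose J hJ using exists_isResolvent_threeSector b ht
  refine ⟨J, ?_, fun y x => ⟨fun h => ?_, fun h => h ▸ hJ y⟩⟩
  · exact (LipschitzWith.of_dist_le_mul (K := 1) fun y₁ y₂ => by
      simpa [dist_eq_norm] using (hJ y₁).norm_sub_le (hJ y₂)).continuous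
  · have := h.norm_sub_le (hJ y)
    rw [sub_self, norm_zero] at this
    exact sub_eq_zero.mp (norm_le_zero_iff.mp this)

/-- Each `y` is a subgradient at exactly one point, `J y + t • q`, so `|∂w_t(B)|` is the pushforward
of Lebesgue measure under a continuous map. -/
theorem isMongeAmpereMeasure_mongeAmpere (hR : ∀ i, ‖v i - q‖ = R) {t : ℝ} (ht : 0 ≤ t) :
    IsMongeAmpereMeasure (convexPotential (threeSector v) t)
      (mongeAmpere (convexPotential (threeSector v) t)) := by
  obtain ⟨J, hJc, hJ⟩ := exists_continuous_isResolvent (fun i => v i - q) ht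
  refine Classical.epsilon_spec (p := IsMongeAmpereMeasure (convexPotential (threeSector v) t))
    ⟨Measure.map (fun y => J y + t • q) volume, fun B hB => ?_⟩
  rw [Measure.map_apply (by fun_prop) hB]
  congr 1
  ext y
  simp only [mem_preimage, mem_iUnion, mem_subgradient_convexPotential_iff hR ht, hJ,
    sub_eq_iff_eq_add]
  exact ⟨fun h => ⟨_, h, rfl⟩, fun ⟨x, hx, hxy⟩ => hxy ▸ hx⟩

theorem massMeasure_eq_mongeAmpere (hR : ∀ i, ‖v i - q‖ = R)
    (h0 : 0 ∈ convexHull ℝ (range fun i => v i - q)) {t : ℝ} (ht : 0 < t) :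
    massMeasure (threeSector v) t = mongeAmpere (convexPotential (threeSector v) t) := by
  have hS := isGradientFlow_lagrangianFlow hR
  ext B hB
  rw [isMongeAmpereMeasure_mongeAmpere hR ht.le B hB, massMeasure,
    Measure.map_apply (continuous_lagrangianFlow hR ht.le).measurable hB]
  congr 1
  ext y
  simp only [mem_preimage, mem_iUnion, mem_subgradient_convexPotential_iff hR ht.le]
  have hy := hS.isResolvent hR h0 ht.le y
  refine ⟨fun h => ⟨_, h, hy⟩, fun ⟨x, hx, hxy⟩ => ?_⟩
  have h1 := hxy.norm_sub_le hy
  rw [sub_self, norm_zero, sub_sub_sub_cancel_right] at h1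
  rwa [← sub_eq_zero.mp (norm_le_zero_iff.mp h1)]

theorem mongeAmpere_singleton_pos (hR : ∀ i, ‖v i - q‖ = R)
    (hint : (interior (convexHull ℝ (range fun i => v i - q))).Nonempty) {t : ℝ} (ht : 0 < t) :
    0 < mongeAmpere (convexPotential (threeSector v) t) {t • q} := by
  rw [isMongeAmpereMeasure_mongeAmpere hR ht.le _ (measurableSet_singleton _)]
  have hpos : 0 < volume (convexHull ℝ (range fun i => v i - q)) :=
    (isOpen_interior.measure_pos volume hint).trans_le (measure_mono interior_subset)
  have hsub : (fun p : EuclideanSpace ℝ (Fin 2) => -t • p) ''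
      convexHull ℝ (range fun i => v i - q) ⊆
        ⋃ x ∈ ({t • q} : Set (EuclideanSpace ℝ (Fin 2))),
          subgradient (convexPotential (threeSector v) t) x := by
    rintro _ ⟨p, hp, rfl⟩
    simp only [mem_singleton_iff, iUnion_iUnion_eq_left,
      mem_subgradient_convexPotential_iff hR ht.le, sub_self]
    exact isResolvent_threeSector_zero ht.le hp
  refine lt_of_lt_of_le ?_ (measure_mono hsub)
  rw [image_smul, Measure.addHaar_smul]
  refine ENNReal.mul_pos ?_ hpos.ne'
  simp only [ne_eq, ENNReal.ofReal_eq_zero, not_le, abs_pos]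
  exact pow_ne_zero _ (neg_ne_zero.mpr ht.ne')

theorem massMeasure_singleton_eq_zero (hR : ∀ i, ‖v i - q‖ = R) {m e : EuclideanSpace ℝ (Fin 2)}
    (hme : IsDriftFrame (threeSector fun i => v i - q) m e) {t : ℝ} (ht : 0 < t)
    (x : EuclideanSpace ℝ (Fin 2)) : massMeasure (threeSector v) t {x} = 0 := by
  rw [massMeasure, Measure.map_apply (continuous_lagrangianFlow hR ht.le).measurable
    (measurableSet_singleton x)]
  have h := hme.measure_flow_fiber_eq_zero volume (isGradientFlow_lagrangianFlow hR)
    (fun a ha x => threeSector_smul ha x) ht (x - t • q)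
  refine measure_mono_null (fun y hy => ?_) h
  have hy' : lagrangianFlow (threeSector v) t y = x := hy
  simp only [mem_preimage, mem_singleton_iff, hy']

end MongeAmpere

/-! ### Translation to the circumcenter and the main theorem. -/

theorem zero_mem_convexHull_range_sub_iff {v : Fin 3 → EuclideanSpace ℝ (Fin 2)}
    {q : EuclideanSpace ℝ (Fin 2)} :
    0 ∈ convexHull ℝ (range fun i => v i - q) ↔ q ∈ convexHull ℝ (range v) := by
  have h : (range fun i => v i - q) = (fun x => -q + x) '' range v := by
    rw [← range_comp]
    congr 1
    ext1 i
    simp [sub_eq_neg_add]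
  have h2 : convexHull ℝ (range fun i => v i - q) =
      (fun x => -q + x) '' convexHull ℝ (range v) := by
    rw [h]
    exact convexHull_vadd (-q) (range v)
  rw [h2]
  constructor
  · rintro ⟨x, hx, hxq⟩
    rwa [← neg_add_eq_zero.mp hxq] at hx
  · exact fun hq => ⟨q, hq, neg_add_cancel q⟩

end Adhesion

end

open Adhesion in
/-- The first four conjuncts say that the viscous flows, their zero-viscosity limit, its
pushforward and the Monge-Ampère measures are well defined; the last three are the claims. -/
theorem proposition6 (v : Fin 3 → EuclideanSpace ℝ (Fin 2)) (hv : AffineIndependent ℝ v)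
    (q : EuclideanSpace ℝ (Fin 2))
    (hq : q = (⟨v, hv⟩ : Affine.Simplex ℝ (EuclideanSpace ℝ (Fin 2)) 2).circumcenter) :
    (∀ ε, 0 < ε → ∀ y, ∃ z, IsViscousPath (threeSector v) ε y z ∧
      ∀ z', IsViscousPath (threeSector v) ε y z' → Set.EqOn z' z (Set.Ici 0)) ∧
    (∀ t, 0 ≤ t → ∀ y, Tendsto (fun ε => viscousFlow (threeSector v) ε t y) (𝓝[>] 0)
      (𝓝 (lagrangianFlow (threeSector v) t y))) ∧
    (∀ t, 0 ≤ t → Continuous (lagrangianFlow (threeSector v) t)) ∧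
    (∀ t, 0 < t → IsMongeAmpereMeasure (convexPotential (threeSector v) t)
      (mongeAmpere (convexPotential (threeSector v) t))) ∧
    List.TFAE [
      q ∈ convexHull ℝ (Set.range v),
      ∀ t, 0 < t → massMeasure (threeSector v) t =
        mongeAmpere (convexPotential (threeSector v) t),
      ∃ t, 0 < t ∧ massMeasure (threeSector v) t =
        mongeAmpere (convexPotential (threeSector v) t)] ∧
    (q ∉ convexHull ℝ (Set.range v) →
      ∀ t, 0 < t → ∀ x, massMeasure (threeSector v) t {x} = 0) ∧
    (∀ t, 0 < t → 0 < mongeAmpere (convexPotential (threeSector v) t) {t • q}) := by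
  have hR : ∀ i, ‖v i - q‖ =
      (⟨v, hv⟩ : Affine.Simplex ℝ (EuclideanSpace ℝ (Fin 2)) 2).circumradius := by
    intro i
    rw [← dist_eq_norm, hq]
    exact Affine.Simplex.dist_circumcenter_eq_circumradius
      (⟨v, hv⟩ : Affine.Simplex ℝ (EuclideanSpace ℝ (Fin 2)) 2) i
  have hspan : affineSpan ℝ (range v) = ⊤ :=
    hv.affineSpan_eq_top_iff_card_eq_finrank_add_one.mpr (by simp)
  obtain ⟨L, hL⟩ := exists_lipschitzWith_threeSector v
  have hint : (interior (convexHull ℝ (range fun i => v i - q))).Nonempty := by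
    rw [interior_convexHull_nonempty_iff_affineSpan_eq_top]
    have hv' : AffineIndependent ℝ fun i => v i - q := by
      have h := hv.vadd (v := -q)
      simp only [sub_eq_neg_add]
      exact h
    exact hv'.affineSpan_eq_top_iff_card_eq_finrank_add_one.mpr (by simp)
  have hatom : q ∉ convexHull ℝ (range v) →
      ∀ t, 0 < t → ∀ x, massMeasure (threeSector v) t {x} = 0 := by
    intro hqn t ht x
    let B : AffineBasis (Fin 3) ℝ (EuclideanSpace ℝ (Fin 2)) := ⟨v, hv, hspan⟩
    have hB : convexHull ℝ (range v) = {x | ∀ i, 0 ≤ B.coord i x} := B.convexHull_eq_nonneg_coord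
    obtain ⟨k, hk⟩ : ∃ k, B.coord k q < 0 := by
      by_contra! hall
      exact hqn (hB ▸ hall)
    have hc1 : ∑ i, B.coord i q = 1 := B.sum_coord_apply_eq_one q
    have hc0 : ∑ i, B.coord i q • (v i - q) = 0 := by
      have h1 : ∑ i, B.coord i q • v i = q := B.linear_combination_coord_eq_self q
      simp only [smul_sub, Finset.sum_sub_distrib, ← Finset.sum_smul]
      rw [h1, hc1, one_smul, sub_self]
    obtain ⟨m, e, hme⟩ := exists_isDriftFrame hR
      (fun i j hij => hv.injective (sub_left_injective hij)) hc1 hc0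
      (fun h => hqn (zero_mem_convexHull_range_sub_iff.mp h)) hk
    exact massMeasure_singleton_eq_zero hR hme ht x
  have hpos : ∀ t, 0 < t → 0 < mongeAmpere (convexPotential (threeSector v) t) {t • q} :=
    fun t ht => mongeAmpere_singleton_pos hR hint ht
  refine ⟨fun ε hε y => ?_, fun t ht y => tendsto_viscousFlow hR ht y,
    fun t ht => continuous_lagrangianFlow hR ht,
    fun t ht => isMongeAmpereMeasure_mongeAmpere hR ht.le, ?_, hatom, hpos⟩
  · have hconc := concaveOn_threeSector v
    obtain ⟨z, hz⟩ := exists_isViscousPath hL hconc hε y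
    exact ⟨z, hz, fun z' hz' => hz'.eqOn hL hconc hε hz⟩
  · tfae_have 1 → 2 := fun h t ht =>
      massMeasure_eq_mongeAmpere hR (zero_mem_convexHull_range_sub_iff.mpr h) ht
    tfae_have 2 → 3 := fun h => ⟨1, one_pos, h 1 one_pos⟩
    -- The point `t • q` is an atom of `μ_t` but, with `q` outside the triangle, not of `ρ_t`.
    tfae_have 3 → 1 := by
      rintro ⟨t, ht, heq⟩
      by_contra hqn
      have h1 := hpos t ht
      rw [← heq, hatom hqn t ht] at h1
      exact lt_irrefl _ h1
    tfae_finish
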